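/- All graphs are finite and simple. An $\ell$-subdivision of a graph $H$ is obtained from $H$ by replacing its edges by pairwise internally disjoint paths of length at most $\ell+1$. A graph $H$ is a topological depth-$r$ minor of $G$ if $G$ contains a $2r$-subdivision of $H$ as a subgraph, and $\widetilde\nabla_r(G)$ denotes the maximum of the edge densities $|E(H)|/|V(H)|$ over all topological depth-$r$ minors $H$ of $G$ (with density $0$ for the graph without vertices). A class $\mathcal C$ of graphs is monotone if it is closed under taking subgraphs. It is nowhere dense if for all real $\epsilon>0$ and all $r\in\mathbb N$ there is $n_0\in\mathbb N$ such that every $n$-vertex graph $G\in\mathcal C$ with $n\ge n_0$ satisfies $\widetilde\nabla_r(G)\le n^{\epsilon}$; otherwise it is somewhere dense. An $r$-neighbourhood cover of a graph $G$ is a set $\mathcal X$ of connected subgraphs of $G$, called clusters, such that for every $v\in V(G)$ there is some $X\in\mathcal X$ that contains all vertices at distance at most $r$ from $v$ in $G$. The radius of $\mathcal X$ is the maximum, over its clusters $X$, of $\min_{u\in V(X)}\max_{v\in V(X)}\operatorname{dist}^X(u,v)$, and the degree of $\mathcal X$ is the maximum, over $v\in V(G)$, of the number of clusters that contain $v$.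 A class $\mathcal C$ admits sparse neighbourhood covers if for every $r\in\mathbb N$ there is $c\in\mathbb N$ such that for every real $\epsilon>0$ there is $n_0\in\mathbb N$ such that every $G\in\mathcal C$ with $|V(G)|\ge n_0$ has an $r$-neighbourhood cover of radius at most $c\cdot r$ and degree at most $|V(G)|^{\epsilon}$. **Theorem.** Let $\mathcal C$ be a monotone class of graphs. If $\mathcal C$ is somewhere dense, then $\mathcal C$ does not admit sparse neighbourhood covers. Moreover, $\mathcal C$ is nowhere dense if and only if it admits sparse neighbourhood covers. -/

import Mathlib

namespace SparseCovers

universe u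

/-! ### Shallow topological minors and edge density -/

/-- The edge density `|E(H)| / |V(H)|` (it is `0` for the graph without vertices). -/
noncomputable def edgeDensity {W : Type*} (H : SimpleGraph W) : ℝ :=
  (H.edgeSet.ncard : ℝ) / (Nat.card W : ℝ)

/-- `G` contains, as a subgraph, an `ℓ`-subdivision of `H`: the vertices of `H` are mapped
injectively to branch vertices of `G`, and the edges of `H` are replaced by paths of `G` of length
at most `ℓ + 1` that join the branch vertices of their ends, that contain no other branch vertex,
and that meet each other in branch vertices only. -/
def ContainsSubdivision {W : Type*} {V : Type*} (ℓ : ℕ) (H : SimpleGraph W) (G : SimpleGraph V) :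
    Prop :=
  ∃ (f : W ↪ V) (P : ∀ u v : W, H.Adj u v → G.Walk (f u) (f v)),
    (∀ (u v : W) (h : H.Adj u v), P v u h.symm = (P u v h).reverse) ∧
    (∀ (u v : W) (h : H.Adj u v), (P u v h).IsPath ∧ (P u v h).length ≤ ℓ + 1) ∧
    (∀ (u v : W) (h : H.Adj u v) (w : W), f w ∈ (P u v h).support → w = u ∨ w = v) ∧
    (∀ (u v : W) (h : H.Adj u v) (u' v' : W) (h' : H.Adj u' v'), s(u, v) ≠ s(u', v') →
      ∀ x : V, x ∈ (P u v h).support → x ∈ (P u' v' h').support → x ∈ Set.range f)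

/-- `H` is a topological depth-`r` minor of `G`: some `2r`-subdivision of `H` is a subgraph
of `G`. -/
def IsTopMinor {W : Type*} {V : Type*} (r : ℕ) (H : SimpleGraph W) (G : SimpleGraph V) : Prop :=
  ContainsSubdivision (2 * r) H G

/-- The edge densities of the topological depth-`r` minors of `G`. Every such minor is, up to
isomorphism, a graph on some `Fin m`. -/
def minorDensities {V : Type*} (r : ℕ) (G : SimpleGraph V) : Set ℝ :=
  {d | ∃ (m : ℕ) (H : SimpleGraph (Fin m)), IsTopMinor r H G ∧ edgeDensity H = d}

/-- The topological greatest reduced average density of `G` with rank `r`: the maximum of the edge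
densities of the topological depth-`r` minors of `G`. The maximum exists, see
`isGreatest_topGrad`. -/
noncomputable def topGrad {V : Type*} (r : ℕ) (G : SimpleGraph V) : ℝ :=
  sSup (minorDensities r G)

theorem isTopMinor_bot_zero {V : Type*} (r : ℕ) (G : SimpleGraph V) :
    IsTopMinor r (⊥ : SimpleGraph (Fin 0)) G := by
  refine ⟨⟨Fin.elim0, fun a => a.elim0⟩, fun u => u.elim0, fun u => u.elim0, fun u => u.elim0,
    fun u => u.elim0, fun u => u.elim0⟩

theorem minorDensities_finite {V : Type*} [Finite V] (r : ℕ) (G : SimpleGraph V) :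
    (minorDensities r G).Finite := by
  have : (⋃ m ∈ Set.Iic (Nat.card V),
      Set.range (fun H : SimpleGraph (Fin m) => edgeDensity H)).Finite :=
    (Set.finite_Iic _).biUnion fun m _ => Set.finite_range _
  refine this.subset ?_
  rintro d ⟨m, H, ⟨f, -⟩, rfl⟩
  have hm : m ≤ Nat.card V := by
    simpa using Finite.card_le_of_embedding f
  exact Set.mem_biUnion (Set.mem_Iic.2 hm) ⟨H, rfl⟩

theorem isGreatest_topGrad {V : Type*} [Finite V] (r : ℕ) (G : SimpleGraph V) :
    IsGreatest (minorDensities r G) (topGrad r G) := by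
  have hne : (minorDensities r G).Nonempty := ⟨_, 0, ⊥, isTopMinor_bot_zero r G, rfl⟩
  exact ⟨hne.csSup_mem (minorDensities_finite r G),
    fun d hd => le_csSup (minorDensities_finite r G).bddAbove hd⟩

/-! ### Neighbourhood covers -/

/-- `N_r(v)`: the vertices at distance at most `r` from `v` (`edist` is `⊤` between different
components). -/
def nbhd {V : Type*} (G : SimpleGraph V) (r : ℕ) (v : V) : Set V :=
  {w | G.edist v w ≤ (r : ℕ∞)}

/-- `𝒳` is an `r`-neighbourhood cover of `G`: a set of connected subgraphs of `G` (the clusters)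
such that every `r`-neighbourhood is contained in some cluster. -/
def IsNbhdCover {V : Type*} (G : SimpleGraph V) (r : ℕ) (𝒳 : Set G.Subgraph) : Prop :=
  (∀ X ∈ 𝒳, X.Connected) ∧ ∀ v : V, ∃ X ∈ 𝒳, nbhd G r v ⊆ X.verts

/-- The radius of a cover: the maximum radius of any of its clusters, where the radius of a
cluster is measured by the distances in the cluster itself. -/
noncomputable def coverRadius {V : Type*} {G : SimpleGraph V} (𝒳 : Set G.Subgraph) : ℕ∞ :=
  ⨆ X ∈ 𝒳, X.coe.radius

/-- The degree of the vertex `v` in a cover: the number of clusters that contain `v`. -/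
noncomputable def degreeAt {V : Type*} {G : SimpleGraph V} (𝒳 : Set G.Subgraph) (v : V) : ℕ :=
  {X ∈ 𝒳 | v ∈ X.verts}.ncard

/-- The degree of a cover of a finite graph: the maximum degree of a vertex in the cover. -/
noncomputable def coverDegree {V : Type*} {G : SimpleGraph V} (𝒳 : Set G.Subgraph) : ℕ :=
  ⨆ v : V, degreeAt 𝒳 v

theorem degreeAt_le_coverDegree {V : Type*} [Finite V] {G : SimpleGraph V} (𝒳 : Set G.Subgraph)
    (v : V) : degreeAt 𝒳 v ≤ coverDegree 𝒳 :=
  le_ciSup (Set.finite_range (degreeAt 𝒳)).bddAbove v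

theorem exists_degreeAt_eq_coverDegree {V : Type*} [Finite V] [Nonempty V] {G : SimpleGraph V}
    (𝒳 : Set G.Subgraph) : ∃ v : V, degreeAt 𝒳 v = coverDegree 𝒳 :=
  exists_eq_ciSup_of_finite

/-! ### Classes of finite graphs -/

/-- A finite simple graph. -/
structure FinGraph : Type (u + 1) where
  /-- The vertices. -/
  V : Type u
  [finite : Finite V]
  /-- The adjacency. -/
  graph : SimpleGraph V

attribute [instance] FinGraph.finite

/-- The number of vertices. -/
noncomputable def FinGraph.order (G : FinGraph.{u}) : ℕ := Nat.card G.V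

/-- A class of graphs is monotone if it is closed under subgraphs. -/
def IsMonotone (C : Set FinGraph.{u}) : Prop :=
  ∀ G ∈ C, ∀ S : G.graph.Subgraph, (⟨S.verts, S.coe⟩ : FinGraph.{u}) ∈ C

/-- A class of graphs is nowhere dense if for every `ε > 0` and `r` all sufficiently large
`n`-vertex graphs in the class have topological greatest reduced average density with rank `r` at
most `n ^ ε`. -/
def IsNowhereDense (C : Set FinGraph.{u}) : Prop :=
  ∀ ε : ℝ, 0 < ε → ∀ r : ℕ, ∃ n₀ : ℕ, ∀ G ∈ C, n₀ ≤ G.order →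
    topGrad r G.graph ≤ (G.order : ℝ) ^ ε

/-- A class of graphs is somewhere dense if it is not nowhere dense. -/
def IsSomewhereDense (C : Set FinGraph.{u}) : Prop := ¬ IsNowhereDense C

/-- A class of graphs admits sparse neighbourhood covers if for every `r` there is `c` such that
for every `ε > 0` all sufficiently large graphs `G` in the class have an `r`-neighbourhood cover of
radius at most `c * r` and degree at most `|V(G)| ^ ε`. -/
def AdmitsSparseCovers (C : Set FinGraph.{u}) : Prop :=
  ∀ r : ℕ, ∃ c : ℕ, ∀ ε : ℝ, 0 < ε → ∃ n₀ : ℕ, ∀ G ∈ C, n₀ ≤ G.order →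
    ∃ 𝒳 : Set G.graph.Subgraph, IsNbhdCover G.graph r 𝒳 ∧
      coverRadius 𝒳 ≤ ((c * r : ℕ) : ℕ∞) ∧ (coverDegree 𝒳 : ℝ) ≤ (G.order : ℝ) ^ ε

end SparseCovers

/-! From nowhere dense to covers. Suppose `topGrad (2 * r) G ≤ d`. Then every nonempty vertex set
`A` has a vertex without a large fan of short walks to `A` (`exists_not_hasFan`), since otherwise
the fans could be glued to a shallow topological minor with more than `d` edges per vertex. Putting
such vertices last, one after the other, orders `G` with small admissibility. A branching argument
then bounds strong reachability (`ncard_SReach_le`), and iteration bounds weak reachability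
(`ncard_WReach_le`), always by polynomials in `d` whose exponent depends on `r` only. The clusters
are the sets of vertices from which a fixed vertex `u` is weakly `2r`-reachable
(`exists_cover_of_order`). Since `d` may be taken as an arbitrarily small power of `n`, so may the
degree.

From covers to nowhere dense. Large girth forces covers to have large degree. If `F` has girth
larger than about twice the diameter of the clusters, then `F` spans only linearly many edges inside
each cluster. As every edge lies in some cluster, the average degree of `F` is at most twice the
degree of the cover; this survives subdividing the edges (`adjCount_le_of_cover`). A somewhere dense
class has graphs with shallow topological minors of density above `n ^ ε`. Such a minor contains an
almost regular dense subgraph (`exists_almost_regular`), and this contains a subgraph of large girth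
whose average degree is still a power of `n` (`exists_high_girth_subgraph`). By monotonicity its
subdivision belongs to the class. The constant `c` in the radius is fixed before the exponent of the
degree, so the girth can be chosen from `c` and the exponent small in terms of the girth, which
gives a contradiction. -/

namespace SparseCovers

universe u

/-! ### Walks through prescribed connector sets -/

/-- There is a walk of length at most `ℓ` from `a` to `b` all of whose other vertices lie
in `S`. -/
def Linked {V : Type*} (G : SimpleGraph V) (ℓ : ℕ) (S : Set V) (a b : V) : Prop :=
  ∃ w : G.Walk a b, w.length ≤ ℓ ∧ ∀ x ∈ w.support, x = a ∨ x = b ∨ x ∈ S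

section Linked

variable {V : Type*} {G : SimpleGraph V} {ℓ ℓ' : ℕ} {S S' : Set V} {a b c : V}

theorem Linked.symm (h : Linked G ℓ S a b) : Linked G ℓ S b a := by
  obtain ⟨w, hl, hs⟩ := h
  refine ⟨w.reverse, by simpa using hl, fun x hx => ?_⟩
  rw [SimpleGraph.Walk.support_reverse, List.mem_reverse] at hx
  rcases hs x hx with h | h | h <;> simp [h]

theorem Linked.mono (h : Linked G ℓ S a b) (hl : ℓ ≤ ℓ') (hS : S ⊆ S') : Linked G ℓ' S' a b := by
  obtain ⟨w, hw, hs⟩ := h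
  refine ⟨w, hw.trans hl, fun x hx => ?_⟩
  rcases hs x hx with h | h | h
  · exact .inl h
  · exact .inr (.inl h)
  · exact .inr (.inr (hS h))

theorem Linked.trans (h : Linked G ℓ S a c) (h' : Linked G ℓ' S' c b) (hc : c ∈ S ∪ S') :
    Linked G (ℓ + ℓ') (S ∪ S') a b := by
  obtain ⟨w, hw, hs⟩ := h
  obtain ⟨w', hw', hs'⟩ := h'
  refine ⟨w.append w', by rw [SimpleGraph.Walk.length_append]; omega, fun x hx => ?_⟩
  rw [SimpleGraph.Walk.mem_support_append_iff] at hx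
  rcases hx with hx | hx
  · rcases hs x hx with h | h | h
    · exact .inl h
    · exact .inr (.inr (h ▸ hc))
    · exact .inr (.inr (.inl h))
  · rcases hs' x hx with h | h | h
    · exact .inr (.inr (h ▸ hc))
    · exact .inr (.inl h)
    · exact .inr (.inr (.inr h))

end Linked

/-- Cut a walk that ends in `T` at its first vertex in `T`. -/
theorem exists_split_walk {V : Type*} {G : SimpleGraph V} (T : Set V) {a b : V}
    (w : G.Walk a b) (hb : b ∈ T) :
    ∃ x ∈ T, ∃ (p : G.Walk a x) (q : G.Walk x b), p.length + q.length = w.length ∧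
      p.support ⊆ w.support ∧ q.support ⊆ w.support ∧ ∀ y ∈ p.support, y ∈ T → y = x := by
  induction w with
  | nil => exact ⟨_, hb, .nil, .nil, by simp, by simp, by simp, by simp⟩
  | @cons u v t h w ih =>
    by_cases hu : u ∈ T
    · exact ⟨u, hu, .nil, .cons h w, by simp, by simp, by simp, by simp⟩
    · obtain ⟨x, hx, p, q, hl, hp, hq, hT⟩ := ih hb
      refine ⟨x, hx, .cons h p, q, by simp only [SimpleGraph.Walk.length_cons]; omega, ?_, ?_, ?_⟩
      · simpa using List.subset_cons_of_subset _ hp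
      · simpa using List.subset_cons_of_subset _ hq
      · intro y hy hyT
        rw [SimpleGraph.Walk.support_cons, List.mem_cons] at hy
        rcases hy with rfl | hy
        · exact absurd hyT hu
        · exact hT y hy hyT

/-- The walk is cut at its first vertex in `T` and shortcut to a path. Being a path, it has the cut
vertex only at its end, so its initial segments link `v` to every vertex of `J` inside `J`; this
last clause lets two truncated walks be spliced at a common vertex. -/
theorem Linked.exists_truncate {V : Type*} {G : SimpleGraph V} {ℓ : ℕ} {I : Set V} {v t : V}
    (h : Linked G ℓ I v t) {T : Set V} (ht : t ∈ T) (hv : v ∉ T) :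
    ∃ x ∈ T, (x = t ∨ x ∈ I) ∧ ∃ J ⊆ I, Disjoint J T ∧ v ∉ J ∧ Linked G ℓ J v x ∧
      ∀ z ∈ J, Linked G ℓ J v z := by
  classical
  obtain ⟨w, hl, hs⟩ := h
  obtain ⟨x, hx, p₀, q, hlen, hp₀, -, hT₀⟩ := exists_split_walk T w ht
  set p := p₀.bypass with hpdef
  have hlp : p.length ≤ ℓ := p₀.length_bypass_le_length.trans (by omega)
  have hp : p.support ⊆ w.support := fun y hy =>
    hp₀ (p₀.support_bypass_subset_support hy)
  have hpath : p.IsPath := p₀.bypass_isPath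
  have hT : ∀ y ∈ p.support, y ∈ T → y = x := fun y hy =>
    hT₀ y (p₀.support_bypass_subset_support hy)
  have hsp : ∀ y ∈ p.support, y = v ∨ y = x ∨ y ∈ {y | y ∈ p.support ∧ y ∉ T ∧ y ≠ v} := by
    intro y hy
    by_cases h1 : y = v
    · exact .inl h1
    by_cases h2 : y ∈ T
    · exact .inr (.inl (hT y hy h2))
    · exact .inr (.inr ⟨hy, h2, h1⟩)
  refine ⟨x, hx, ?_, {y | y ∈ p.support ∧ y ∉ T ∧ y ≠ v}, ?_, ?_, ?_, ⟨p, hlp, hsp⟩, ?_⟩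
  · rcases hs x (hp p.end_mem_support) with h | h | h
    · exact absurd (h ▸ hx) hv
    · exact .inl h
    · exact .inr h
  · rintro y ⟨hy, hyT, hyv⟩
    rcases hs y (hp hy) with h | h | h
    · exact absurd h hyv
    · exact absurd (h ▸ ht) hyT
    · exact h
  · exact Set.disjoint_left.2 fun y hy hyT => hy.2.1 hyT
  · exact fun h => h.2.2 rfl
  · intro z hz
    refine ⟨p.takeUntil z hz.1, (p.length_takeUntil_le_length hz.1).trans hlp, fun y hy => ?_⟩
    have hy' := p.support_takeUntil_subset_support hz.1 hy
    rcases hsp y hy' with h | h | h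
    · exact .inl h
    · by_cases h1 : y = v
      · exact .inl h1
      · rw [h] at hy
        refine absurd hy (SimpleGraph.Walk.endpoint_notMem_support_takeUntil hpath hz.1 ?_)
        rintro rfl
        exact hz.2.1 hx
    · exact .inr (.inr h)

/-! ### Building topological minors -/

theorem ContainsSubdivision.comap {W W' V : Type*} {ℓ : ℕ} {H : SimpleGraph W}
    {H' : SimpleGraph W'} {G : SimpleGraph V} (h : ContainsSubdivision ℓ H G) (g : W' ↪ W)
    (hg : ∀ u v, H'.Adj u v → H.Adj (g u) (g v)) : ContainsSubdivision ℓ H' G := by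
  obtain ⟨f, P, h1, h2, h3, h4⟩ := h
  refine ⟨g.trans f, fun u v h => P _ _ (hg u v h), fun u v h => h1 _ _ _,
    fun u v h => h2 _ _ _, ?_, ?_⟩
  · intro u v h w hw
    rcases h3 _ _ _ _ hw with h | h
    · exact .inl (g.injective h)
    · exact .inr (g.injective h)
  · intro u v h u' v' h' hne x hx hx'
    have hne' : s(g u, g v) ≠ s(g u', g v') := by
      intro he
      apply hne
      apply Sym2.map.injective g.injective
      simpa using he
    obtain ⟨w, rfl⟩ := h4 _ _ _ _ _ _ hne' x hx hx'
    rcases h3 _ _ _ _ hx with h | h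
    · exact ⟨u, by simp [h]⟩
    · exact ⟨v, by simp [h]⟩

theorem containsSubdivision_of_linked {W V : Type*} {ℓ : ℕ} {H : SimpleGraph W}
    {G : SimpleGraph V} (f : W ↪ V) (S : Sym2 W → Set V)
    (hS : ∀ e ∈ H.edgeSet, ∀ w, f w ∉ S e)
    (hd : ∀ e ∈ H.edgeSet, ∀ e' ∈ H.edgeSet, e ≠ e' → Disjoint (S e) (S e'))
    (hw : ∀ u v, H.Adj u v → Linked G (ℓ + 1) (S s(u, v)) (f u) (f v)) :
    ContainsSubdivision ℓ H G := by
  classical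
  -- An arbitrary order on `W` selects one orientation of each edge; the opposite orientation
  -- receives the reversed path.
  let _ : LinearOrder W := linearOrderOfSTO WellOrderingRel
  choose w hl hs using hw
  let P : ∀ u v : W, H.Adj u v → G.Walk (f u) (f v) := fun u v h =>
    if u < v then (w u v h).bypass else (w v u h.symm).bypass.reverse
  have hP : ∀ u v (h : H.Adj u v), (P u v h).IsPath ∧ (P u v h).length ≤ ℓ + 1 ∧
      ∀ x ∈ (P u v h).support, x = f u ∨ x = f v ∨ x ∈ S s(u, v) := by
    intro u v h
    by_cases huv : u < v
    · simp only [P, if_pos huv]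
      exact ⟨(w u v h).bypass_isPath, ((w u v h).length_bypass_le_length).trans (hl u v h),
        fun x hx => hs u v h x ((w u v h).support_bypass_subset_support hx)⟩
    · simp only [P, if_neg huv]
      refine ⟨((w v u h.symm).bypass_isPath).reverse, ?_, fun x hx => ?_⟩
      · rw [SimpleGraph.Walk.length_reverse]
        exact ((w v u h.symm).length_bypass_le_length).trans (hl v u h.symm)
      · rw [SimpleGraph.Walk.support_reverse, List.mem_reverse] at hx
        have := hs v u h.symm x ((w v u h.symm).support_bypass_subset_support hx)
        rw [Sym2.eq_swap]
        tauto
  refine ⟨f, P, ?_, fun u v h => ⟨(hP u v h).1, (hP u v h).2.1⟩, ?_, ?_⟩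
  · intro u v h
    rcases lt_or_gt_of_ne h.ne with huv | huv
    · simp only [P, if_pos huv, if_neg huv.not_gt]
    · simp only [P, if_pos huv, if_neg huv.not_gt, SimpleGraph.Walk.reverse_reverse]
  · intro u v h x hx
    rcases (hP u v h).2.2 _ hx with h' | h' | h'
    · exact .inl (f.injective h')
    · exact .inr (f.injective h')
    · exact absurd h' (hS _ h x)
  · intro u v h u' v' h' hne x hx hx'
    rcases (hP u v h).2.2 _ hx with e | e | e
    · exact ⟨u, e.symm⟩
    · exact ⟨v, e.symm⟩
    rcases (hP u' v' h').2.2 _ hx' with e' | e' | e'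
    · exact ⟨u', e'.symm⟩
    · exact ⟨v', e'.symm⟩
    exact absurd e' (Set.disjoint_left.1 (hd _ h _ h' hne) e)

/-- The number of edges of a topological minor is bounded through `topGrad`. -/
theorem ncard_edgeSet_le_of_topGrad_le {W V : Type*} [Finite V] {r d : ℕ} {G : SimpleGraph V}
    (hd : topGrad r G ≤ d) {H : SimpleGraph W} (h : IsTopMinor r H G) :
    H.edgeSet.ncard ≤ d * Nat.card W := by
  have : Finite W := by
    obtain ⟨f, -⟩ := h
    exact Finite.of_injective f f.injective
  let e := Finite.equivFin W
  let H' : SimpleGraph (Fin (Nat.card W)) := H.comap e.symm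
  have hH' : IsTopMinor r H' G := ContainsSubdivision.comap h e.symm.toEmbedding fun u v h => h
  have h1 := ((isGreatest_topGrad r G).2 ⟨_, H', hH', rfl⟩).trans hd
  have h2 : H'.edgeSet.ncard = H.edgeSet.ncard := by
    have i : H' ≃g H := SimpleGraph.Iso.comap e.symm H
    exact Nat.card_congr i.mapEdgeSet
  rcases Nat.eq_zero_or_pos (Nat.card W) with h0 | h0
  · have : IsEmpty W := (Nat.card_eq_zero.1 h0).resolve_right (by simpa using this)
    have : H.edgeSet = ∅ := by
      ext e
      induction e with | _ a b => exact this.elim a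
    simp [this]
  · rw [edgeDensity, div_le_iff₀ (by simpa using h0), h2, Nat.card_fin] at h1
    exact_mod_cast h1

/-- The pairs `s(a i, x i)` are distinct edges of a graph on `W`, and the disjoint connectors make
this graph a depth-`r` topological minor, so its density is at most `d`. -/
theorem card_le_of_linked_family {V ι : Type*} [Finite V] [Fintype ι] {r d : ℕ}
    {G : SimpleGraph V} (hd : topGrad r G ≤ d) (W : Finset V) (a x : ι → V) (J : ι → Set V)
    (ha : ∀ i, a i ∈ W) (hx : ∀ i, x i ∈ W) (hax : ∀ i, a i ≠ x i)
    (hJ : ∀ i, ∀ z ∈ J i, z ∉ W) (hJJ : ∀ i j, i ≠ j → Disjoint (J i) (J j))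
    (hinj : Function.Injective fun i => s(a i, x i))
    (hl : ∀ i, Linked G (2 * r + 1) (J i) (a i) (x i)) :
    Fintype.card ι ≤ d * W.card := by
  classical
  let m : ι → Sym2 W := fun i => s(⟨a i, ha i⟩, ⟨x i, hx i⟩)
  have hm : Function.Injective m := by
    intro i j hij
    apply hinj
    simpa [m] using congrArg (Sym2.map Subtype.val) hij
  let H : SimpleGraph W := SimpleGraph.fromEdgeSet (Set.range m)
  have hE : H.edgeSet = Set.range m := by
    rw [SimpleGraph.edgeSet_fromEdgeSet, sdiff_eq_left, Set.disjoint_left]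
    rintro _ ⟨i, rfl⟩ h
    exact hax i (by simpa [m] using h)
  have hH : IsTopMinor r H G := by
    refine containsSubdivision_of_linked (Function.Embedding.subtype _)
      (fun e => {z | ∃ i, e = m i ∧ z ∈ J i}) ?_ ?_ ?_
    · rintro e - w ⟨i, -, hi⟩
      exact hJ i _ hi w.2
    · intro e _ e' _ hne
      refine Set.disjoint_left.2 ?_
      rintro z ⟨i, rfl, hi⟩ ⟨j, rfl, hj⟩
      exact Set.disjoint_left.1 (hJJ i j fun h => hne (by rw [h])) hi hj
    · intro u v huv
      have : s(u, v) ∈ Set.range m := by rw [← hE]; exact huv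
      obtain ⟨i, hi⟩ := this
      have hsub : J i ⊆ {z | ∃ i, s(u, v) = m i ∧ z ∈ J i} := fun z hz => ⟨i, hi.symm, hz⟩
      have h1 := (hl i).mono le_rfl hsub
      rw [Sym2.eq_iff] at hi
      rcases hi with ⟨rfl, rfl⟩ | ⟨rfl, rfl⟩
      · exact h1
      · exact h1.symm
  have h1 := ncard_edgeSet_le_of_topGrad_le hd hH
  rw [hE, ← Set.image_univ, Set.ncard_image_of_injective _ hm, Set.ncard_univ,
    Nat.card_eq_fintype_card, Nat.card_eq_fintype_card, Fintype.card_coe] at h1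
  exact h1

/-! ### Admissibility -/

/-- The average degree is at most `2 * d`, so at least half of the vertices have degree at most `4 *
d`. A maximal independent set among these dominates all of them, and each member accounts for at
most `4 * d + 1`. -/
theorem exists_large_independent {W : Type*} [Fintype W] (H : SimpleGraph W) {d : ℕ}
    (h : H.edgeSet.ncard ≤ d * Fintype.card W) :
    ∃ R : Finset W, (∀ u ∈ R, ∀ v ∈ R, ¬ H.Adj u v) ∧
      Fintype.card W ≤ 2 * (4 * d + 1) * R.card := by
  classical
  let B : Finset W := Finset.univ.filter fun v => H.degree v ≤ 4 * d
  have hB : Fintype.card W ≤ 2 * B.card := by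
    have h1 := H.sum_degrees_eq_twice_card_edges
    rw [← SimpleGraph.coe_edgeFinset, Set.ncard_coe_finset] at h
    have h2 : (4 * d + 1) * Bᶜ.card ≤ ∑ v, H.degree v := by
      calc (4 * d + 1) * Bᶜ.card = ∑ v ∈ Bᶜ, (4 * d + 1) := by simp [mul_comm]
        _ ≤ ∑ v ∈ Bᶜ, H.degree v := Finset.sum_le_sum fun v hv => by
          have : ¬ H.degree v ≤ 4 * d := by simpa [B] using hv
          omega
        _ ≤ ∑ v, H.degree v := Finset.sum_le_sum_of_subset (Finset.subset_univ _)
    have h3 := Finset.card_add_card_compl B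
    by_contra hc
    have h4 : Fintype.card W + 1 ≤ 2 * Bᶜ.card := by omega
    nlinarith
  obtain ⟨R, hR⟩ := (B.powerset.filter fun R => ∀ u ∈ R, ∀ v ∈ R, ¬ H.Adj u v).exists_maximal
    ⟨∅, by simp⟩
  have hR1 := hR.1
  simp only [Finset.mem_filter, Finset.mem_powerset] at hR1
  refine ⟨R, hR1.2, ?_⟩
  have hsub : B ⊆ R.biUnion fun v => insert v (H.neighborFinset v) := by
    intro b hb
    simp only [Finset.mem_biUnion, Finset.mem_insert, SimpleGraph.mem_neighborFinset]
    by_contra hc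
    push Not at hc
    have hbR : b ∉ R := fun hbR => (hc b hbR).1 rfl
    have : insert b R ≤ R := by
      apply hR.2 _ (Finset.subset_insert b R)
      simp only [Finset.mem_filter, Finset.mem_powerset, Finset.insert_subset_iff,
        Finset.mem_insert]
      refine ⟨⟨hb, hR1.1⟩, ?_⟩
      rintro u (rfl | hu) v (rfl | hv)
      · exact H.irrefl
      · exact fun h => (hc v hv).2 h.symm
      · exact (hc u hu).2
      · exact hR1.2 u hu v hv
    exact hbR (this (Finset.mem_insert_self b R))
  have h5 : B.card ≤ R.card * (4 * d + 1) := by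
    refine (Finset.card_le_card hsub).trans (Finset.card_biUnion_le_card_mul _ _ _ ?_)
    intro v hv
    refine (Finset.card_insert_le _ _).trans ?_
    have := hR1.1 hv
    simp only [B, Finset.mem_filter, Finset.mem_univ, true_and] at this
    rw [SimpleGraph.card_neighborFinset_eq_degree]
    omega
  nlinarith

/-- There are `k` walks of length at most `r` from `v` to distinct vertices of `A` that meet only
in `v` and have their interior vertices outside of `A`. -/
def HasFan {V : Type*} (G : SimpleGraph V) (r : ℕ) (A : Set V) (v : V) (k : ℕ) : Prop :=
  ∃ (s : Finset V) (t : V → V) (I : V → Set V), s.card = k ∧ Set.InjOn t s ∧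
    (∀ i ∈ s, t i ∈ A ∧ t i ≠ v ∧ Disjoint (I i) A ∧ Linked G r (I i) v (t i)) ∧
    ∀ i ∈ s, ∀ j ∈ s, i ≠ j → Disjoint (I i) (I j)

/-- A graph `H` on `A` whose edges are realised by disjoint connector sets outside of `A`. -/
def IsConnectorSystem {V : Type*} (G : SimpleGraph V) (r : ℕ) (A : Finset V)
    (H : SimpleGraph A) (S : Sym2 A → Finset V) : Prop :=
  (∀ e ∈ H.edgeSet, Disjoint (S e) A ∧ (S e).card ≤ 2 * r + 1) ∧
  (∀ e ∈ H.edgeSet, ∀ e' ∈ H.edgeSet, e ≠ e' → Disjoint (S e) (S e')) ∧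
  ∀ u v : A, H.Adj u v → Linked G (2 * r) (S s(u, v)) u v

theorem IsConnectorSystem.isTopMinor {V : Type*} {G : SimpleGraph V} {r : ℕ} {A : Finset V}
    {H : SimpleGraph A} {S : Sym2 A → Finset V} (h : IsConnectorSystem G r A H S) :
    IsTopMinor r H G :=
  containsSubdivision_of_linked (Function.Embedding.subtype _) (fun e => (S e : Set V))
    (fun e he w hw => Finset.disjoint_left.1 (h.1 e he).1 hw w.2)
    (fun e he e' he' hne => Finset.disjoint_coe.2 (h.2.1 e he e' he' hne))
    (fun u v huv => (h.2.2 u v huv).mono (Nat.le_succ _) subset_rfl)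

theorem IsConnectorSystem.exists_extend {V : Type*} {G : SimpleGraph V} {r : ℕ} {A : Finset V}
    {H : SimpleGraph A} {S : Sym2 A → Finset V} (h : IsConnectorSystem G r A H S) {u v : A}
    (huv : u ≠ v) (hadj : ¬ H.Adj u v) {J : Set V} (hJA : ∀ z ∈ J, z ∉ A)
    (hJS : ∀ z ∈ J, ∀ e ∈ H.edgeSet, z ∉ S e) (hl : Linked G (2 * r) J u v) :
    ∃ S', IsConnectorSystem G r A (H ⊔ SimpleGraph.edge u v) S' := by
  classical
  obtain ⟨w, hw, hs⟩ := hl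
  let D : Finset V := w.support.toFinset \ A
  have hD : ∀ z ∈ D, z ∈ J := by
    intro z hz
    simp only [D, Finset.mem_sdiff, List.mem_toFinset] at hz
    rcases hs z hz.1 with h | h | h
    · exact absurd (h ▸ u.2) hz.2
    · exact absurd (h ▸ v.2) hz.2
    · exact h
  have hE : ∀ e ∈ (H ⊔ SimpleGraph.edge u v).edgeSet, e = s(u, v) ∨ (e ∈ H.edgeSet ∧
      e ≠ s(u, v)) := by
    intro e he
    rw [SimpleGraph.edgeSet_sup, SimpleGraph.edgeSet_edge_of_ne huv] at he
    rcases he with he | he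
    · exact .inr ⟨he, fun h' => hadj (by rw [h'] at he; exact he)⟩
    · exact .inl he
  have hDS : ∀ e ∈ H.edgeSet, Disjoint D (S e) := fun e he =>
    Finset.disjoint_left.2 fun z hz => hJS z (hD z hz) e he
  refine ⟨Function.update S s(u, v) D, ?_, ?_, ?_⟩
  · intro e he
    rcases hE e he with rfl | ⟨he, hne⟩
    · rw [Function.update_self]
      refine ⟨Finset.sdiff_disjoint, ?_⟩
      refine (Finset.card_le_card Finset.sdiff_subset).trans ?_
      refine (List.toFinset_card_le _).trans ?_
      rw [SimpleGraph.Walk.length_support]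
      omega
    · rw [Function.update_of_ne hne]
      exact h.1 e he
  · intro e he e' he' hee
    rcases hE e he with rfl | ⟨he, hne⟩ <;> rcases hE e' he' with rfl | ⟨he', hne'⟩
    · exact absurd rfl hee
    · rw [Function.update_self, Function.update_of_ne hne']
      exact hDS e' he'
    · rw [Function.update_self, Function.update_of_ne hne]
      exact (hDS e he).symm
    · rw [Function.update_of_ne hne, Function.update_of_ne hne']
      exact h.2.1 e he e' he' hee
  · have hlink : Linked G (2 * r) (D : Set V) u v := by
      refine ⟨w, hw, fun x hx => ?_⟩
      rcases hs x hx with h | h | h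
      · exact .inl h
      · exact .inr (.inl h)
      · exact .inr (.inr (by simpa [D] using ⟨hx, hJA x h⟩))
    intro a b hab
    rcases hE s(a, b) hab with hab | ⟨hab, hne⟩
    · rw [hab, Function.update_self]
      rw [Sym2.eq_iff] at hab
      rcases hab with ⟨rfl, rfl⟩ | ⟨rfl, rfl⟩
      · exact hlink
      · exact hlink.symm
    · rw [Function.update_of_ne hne]
      exact h.2.2 a b hab

/-- A maximal connector system on `A` has at most `d * |A|` edges, so its connectors cover a set `M`
of size linear in `|A|`, and it has an independent set `R` of linear size. If all vertices had fans,
the fans of `R`, cut at `A ∪ M`, would form a topological minor on `A ∪ M` with `k * |R|` edges,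
which is too many. -/
theorem exists_not_hasFan {V : Type*} [Fintype V] {G : SimpleGraph V} {r d k : ℕ}
    (hd : topGrad r G ≤ d) (hk : 2 * d * (1 + (2 * r + 1) * d) * (4 * d + 1) < k)
    {A : Finset V} (hA : A.Nonempty) : ∃ v ∈ A, ¬ HasFan G r A v k := by
  classical
  by_contra! hfan
  obtain ⟨H, ⟨S, hS⟩, hmax⟩ :=
    (Set.toFinite {H : SimpleGraph A | ∃ S, IsConnectorSystem G r A H S}).exists_maximal
      ⟨⊥, fun _ => ∅, by simp, by simp, by simp⟩
  have hEd : H.edgeSet.ncard ≤ d * A.card := by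
    simpa using ncard_edgeSet_le_of_topGrad_le hd hS.isTopMinor
  obtain ⟨R, hRind, hRcard⟩ := exists_large_independent H (d := d) (by simpa using hEd)
  rw [Fintype.card_coe] at hRcard
  let M : Finset V := H.edgeFinset.biUnion S
  have hM : M.card ≤ d * A.card * (2 * r + 1) := by
    rw [← SimpleGraph.coe_edgeFinset, Set.ncard_coe_finset] at hEd
    refine (Finset.card_biUnion_le_card_mul _ _ (2 * r + 1) ?_).trans
      (Nat.mul_le_mul_right _ hEd)
    exact fun e he => (hS.1 e (by simpa using he)).2
  -- Such a link would be a new connector, against maximality.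
  have hno : ∀ u v : A, u ∈ R → v ∈ R → u ≠ v → ∀ J : Set V, (∀ z ∈ J, z ∉ A ∪ M) →
      ¬ Linked G (2 * r) J u v := by
    intro u v hu hv huv J hJ hl
    have hadj := hRind u hu v hv
    have hex := hS.exists_extend huv hadj (fun z hz hzA => hJ z hz (by simp [hzA]))
      (fun z hz e he hzS => hJ z hz (Finset.mem_union_right _
        (Finset.mem_biUnion.2 ⟨e, by simpa using he, hzS⟩))) hl
    apply hadj
    apply hmax hex le_sup_left
    rw [SimpleGraph.sup_adj, SimpleGraph.edge_adj]
    exact .inr ⟨.inl ⟨rfl, rfl⟩, huv⟩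
  have hfan' : ∀ v : R, ∃ (s : Finset V), s.card = k ∧ ∃ (x : s → V) (J : s → Set V),
      (∀ i, x i ∈ A ∪ M ∧ x i ≠ v.1 ∧ (∀ z ∈ J i, z ∉ A ∪ M) ∧ Linked G r (J i) v.1 (x i) ∧
        ∀ z ∈ J i, Linked G r (J i) v.1 z) ∧ Function.Injective x ∧
      ∀ i j, i ≠ j → Disjoint (J i) (J j) := by
    intro v
    obtain ⟨s, t, I, hs, ht, hI, hII⟩ := hfan v.1 v.1.2
    refine ⟨s, hs, ?_⟩
    have : ∀ i : s, ∃ x ∈ {x | x ∈ A ∪ M ∧ x ≠ v.1}, (x = t i ∨ x ∈ I i) ∧ ∃ J ⊆ I i,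
        Disjoint J {x | x ∈ A ∪ M ∧ x ≠ v.1} ∧ v.1.1 ∉ J ∧ Linked G r J v.1 x ∧
        ∀ z ∈ J, Linked G r J v.1 z := by
      intro i
      obtain ⟨h1, h2, h3, h4⟩ := hI i i.2
      exact h4.exists_truncate ⟨by simpa using .inl h1, h2⟩ (by simp)
    choose x hx hxt J hJI hJT hvJ hl hlz using this
    refine ⟨x, J, fun i => ⟨(hx i).1, (hx i).2, ?_, hl i, hlz i⟩, ?_, ?_⟩
    · intro z hz hzA
      exact Set.disjoint_left.1 (hJT i) hz ⟨hzA, fun h => hvJ i (h ▸ hz)⟩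
    · intro i j hij
      by_contra hne
      have hne' : i.1 ≠ j.1 := fun h => hne (Subtype.ext h)
      have hi := hxt i
      rw [hij] at hi
      rcases hi with hi | hi <;> rcases hxt j with hj | hj
      · exact hne' (ht i.2 j.2 (hi.symm.trans hj))
      · exact Set.disjoint_left.1 (hI j j.2).2.2.1 hj (hi ▸ (hI i i.2).1)
      · exact Set.disjoint_left.1 (hI i i.2).2.2.1 hi (hj ▸ (hI j j.2).1)
      · exact Set.disjoint_left.1 (hII i i.2 j j.2 hne') hi hj
    · intro i j hij
      exact (hII i i.2 j j.2 fun h => hij (Subtype.ext h)).mono (hJI i) (hJI j)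
  choose s hs x J hx hxinj hJJ using hfan'
  -- No cut fan ends in `R`; hence fans of different centres never realise the same edge.
  have hxR : ∀ (v : R) (i : s v) (w : R), x v i ≠ w.1 := by
    intro v i w h
    obtain ⟨-, h2, h3, h4, -⟩ := hx v i
    refine hno v.1 w.1 v.2 w.2 (fun hvw => h2 (by rw [h, hvw])) (J v i) h3 ?_
    rw [← h]
    exact h4.mono (by omega) subset_rfl
  have hcard := card_le_of_linked_family (ι := Σ v : R, s v) hd (A ∪ M) (fun i => i.1.1)
    (fun i => x i.1 i.2) (fun i => J i.1 i.2) (fun i => by simp [i.1.1.2])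
    (fun i => (hx i.1 i.2).1) (fun i => (hx i.1 i.2).2.1.symm)
    (fun i => (hx i.1 i.2).2.2.1) ?_ ?_
    (fun i => (hx i.1 i.2).2.2.2.1.mono (by omega) subset_rfl)
  · rw [Fintype.card_sigma] at hcard
    simp only [Fintype.card_coe, hs, Finset.sum_const, Finset.card_univ, smul_eq_mul] at hcard
    have hAM : (A ∪ M).card ≤ A.card + d * A.card * (2 * r + 1) :=
      (Finset.card_union_le _ _).trans (by omega)
    have hRpos : 0 < R.card := by
      rcases Nat.eq_zero_or_pos R.card with h | h
      · rw [h, mul_zero] at hRcard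
        exact absurd hRcard (by simpa using hA.ne_empty)
      · exact h
    have h1 : R.card * k ≤ d * ((1 + (2 * r + 1) * d) * A.card) :=
      hcard.trans (Nat.mul_le_mul_left _ (hAM.trans (by nlinarith)))
    have h2 : R.card * k ≤ R.card * (2 * d * (1 + (2 * r + 1) * d) * (4 * d + 1)) := by
      refine h1.trans ((Nat.mul_le_mul_left _ (Nat.mul_le_mul_left _ hRcard)).trans ?_)
      exact le_of_eq (by ring)
    exact absurd (Nat.le_of_mul_le_mul_left h2 hRpos) (by omega)
  -- A vertex shared by the connectors of two centres would splice them into a link of length at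
  -- most `2 * r` between two vertices of `R`, which `hno` excludes.
  · rintro ⟨v, i⟩ ⟨w, j⟩ hne
    by_cases hvw : v = w
    · subst hvw
      exact hJJ v i j fun h => hne (by rw [h])
    · refine Set.disjoint_left.2 fun z hz hz' => ?_
      refine hno v.1 w.1 v.2 w.2 (fun h => hvw (Subtype.ext h)) (J v i ∪ J w j) ?_ ?_
      · rintro y (hy | hy)
        · exact (hx v i).2.2.1 y hy
        · exact (hx w j).2.2.1 y hy
      · have := ((hx v i).2.2.2.2 z hz).trans ((hx w j).2.2.2.2 z hz').symm (.inl hz)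
        exact this.mono (by omega) subset_rfl
  · rintro ⟨v, i⟩ ⟨w, j⟩ h
    simp only [Sym2.eq_iff] at h
    rcases h with ⟨h1, h2⟩ | ⟨h1, h2⟩
    · have hvw : v = w := Subtype.ext (Subtype.ext h1)
      subst hvw
      rw [hxinj v h2]
    · exact absurd h2 (hxR v i w)

/-! ### Admissible orders and generalised colouring numbers -/

/-- `L` is an ordering of the vertices in which no vertex has a fan of size `k` to the smaller
vertices. -/
def IsAdmissible {V : Type*} (G : SimpleGraph V) (r k : ℕ) (L : V → ℕ) : Prop :=
  L.Injective ∧ ∀ v, ¬ HasFan G r {u | L u ≤ L v} v k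

/-- The order is built from its end: a vertex of the remaining set `A` without a fan to `A` receives
the largest label, and the rest is ordered recursively. -/
theorem exists_isAdmissible {V : Type*} [Fintype V] {G : SimpleGraph V} {r k : ℕ}
    (h : ∀ A : Finset V, A.Nonempty → ∃ v ∈ A, ¬ HasFan G r A v k) :
    ∃ L, IsAdmissible G r k L := by
  classical
  have key : ∀ A : Finset V, ∃ L : V → ℕ, Set.InjOn L A ∧ (∀ v ∈ A, L v < A.card) ∧
      ∀ v ∈ A, ¬ HasFan G r {u | u ∈ A ∧ L u ≤ L v} v k := by
    intro A
    induction hn : A.card generalizing A with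
    | zero =>
      rw [Finset.card_eq_zero] at hn
      subst hn
      exact ⟨fun _ => 0, by simp, by simp, by simp⟩
    | succ n ih =>
      obtain ⟨v, hv, hfan⟩ := h A (Finset.card_pos.1 (by omega))
      obtain ⟨L, hinj, hlt, hL⟩ := ih (A.erase v) (by rw [Finset.card_erase_of_mem hv, hn]; rfl)
      have hval : ∀ u ∈ A, u ≠ v → Function.update L v n u = L u ∧ L u < n := fun u hu huv =>
        ⟨Function.update_of_ne huv _ _, hlt u (Finset.mem_erase.2 ⟨huv, hu⟩)⟩
      refine ⟨Function.update L v n, ?_, ?_, ?_⟩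
      · intro a ha b hb hab
        by_cases h1 : a = v <;> by_cases h2 : b = v
        · rw [h1, h2]
        · obtain ⟨e, hb'⟩ := hval b hb h2
          rw [h1, Function.update_self, e] at hab
          omega
        · obtain ⟨e, ha'⟩ := hval a ha h1
          rw [h2, Function.update_self, e] at hab
          omega
        · rw [(hval a ha h1).1, (hval b hb h2).1] at hab
          exact hinj (Finset.mem_erase.2 ⟨h1, ha⟩) (Finset.mem_erase.2 ⟨h2, hb⟩) hab
      · intro u hu
        by_cases h1 : u = v
        · rw [h1, Function.update_self]
          omega
        · have := hval u hu h1
          omega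
      · intro u hu
        by_cases h1 : u = v
        · subst h1
          have : {w | w ∈ A ∧ Function.update L u n w ≤ Function.update L u n u} = A := by
            ext w
            simp only [Function.update_self, Set.mem_ofPred_eq, Finset.mem_coe, and_iff_left_iff_imp]
            intro hw
            by_cases h2 : w = u
            · rw [h2, Function.update_self]
            · have := hval w hw h2
              omega
          rwa [this]
        · have : {w | w ∈ A ∧ Function.update L v n w ≤ Function.update L v n u} =
              {w | w ∈ A.erase v ∧ L w ≤ L u} := by
            ext w
            have hu' := hval u hu h1
            simp only [Set.mem_ofPred_eq, Finset.mem_erase]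
            by_cases h2 : w = v
            · subst h2
              simp only [Function.update_self, hu'.1]
              constructor
              · rintro ⟨-, h3⟩
                omega
              · rintro ⟨⟨h3, -⟩, -⟩
                exact absurd rfl h3
            · rw [Function.update_of_ne h2, hu'.1]
              tauto
          rw [this]
          exact hL u (Finset.mem_erase.2 ⟨h1, hu⟩)
  obtain ⟨L, hinj, -, hL⟩ := key Finset.univ
  refine ⟨L, fun a b hab => hinj (by simp) (by simp) hab, fun v => ?_⟩
  simpa using hL v (Finset.mem_univ v)

/-- The vertices below `v` that are strongly `r`-reachable from `v`. -/
def SReach {V : Type*} (G : SimpleGraph V) (L : V → ℕ) (r : ℕ) (v : V) : Set V :=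
  {y | L y < L v ∧ ∃ w : G.Walk v y, w.length ≤ r ∧ ∀ z ∈ w.support, z ≠ y → L v ≤ L z}

/-- The vertices that are weakly `r`-reachable from `v`. -/
def WReach {V : Type*} (G : SimpleGraph V) (L : V → ℕ) (r : ℕ) (v : V) : Set V :=
  {y | ∃ w : G.Walk v y, w.length ≤ r ∧ ∀ z ∈ w.support, L y ≤ L z}

/-- A tree of paths from `v` to the targets in `Y`, given by parent pointers `π` and depths
`dep`, whose vertices outside of `Y` lie in `U`. -/
structure IsParentTree {V : Type*} (G : SimpleGraph V) (r : ℕ) (v : V) (U Y Z : Set V)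
    (π : V → V) (dep : V → ℕ) : Prop where
  targets : Y ⊆ Z
  disj : ∀ z ∈ Z, z ∉ Y → z ∈ U
  depth_root : dep v = 0
  depth_le : ∀ y ∈ Y, dep y ≤ r
  root_notMem : v ∉ Y
  step : ∀ z ∈ Z, z ≠ v → π z ∈ Z ∧ π z ∉ Y ∧ G.Adj (π z) z ∧ dep z = dep (π z) + 1
  root_eq : ∀ z ∈ Z, dep z = 0 → z = v

theorem exists_last_step {V : Type*} {G : SimpleGraph V} {U : Set V} {a y : V}
    (w : G.Walk a y) (ha : a ≠ y) (hU : ∀ z ∈ w.support, z ≠ y → z ∈ U) :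
    ∃ p ∈ U, G.Adj p y ∧ ∃ q : G.Walk a p, q.length + 1 ≤ w.length ∧ ∀ z ∈ q.support, z ∈ U := by
  induction w with
  | nil => exact absurd rfl ha
  | @cons a b y h w ih =>
    have haU : a ∈ U := hU a (by simp) ha
    by_cases hb : b = y
    · subst hb
      exact ⟨a, haU, h, .nil, by simp, by simpa using haU⟩
    · obtain ⟨p, hp, hpy, q, hq, hqU⟩ := ih hb fun z hz => hU z (by simp [hz])
      refine ⟨p, hp, hpy, .cons h q, by simpa using hq, ?_⟩
      intro z hz
      rw [SimpleGraph.Walk.support_cons, List.mem_cons] at hz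
      rcases hz with rfl | hz
      · exact haU
      · exact hqU z hz

theorem exists_walk_of_support_subset {V : Type*} {G G' : SimpleGraph V} {U : Set V}
    (hG : ∀ a b, a ∈ U → b ∈ U → G.Adj a b → G'.Adj a b) {a b : V} (w : G.Walk a b)
    (hw : ∀ z ∈ w.support, z ∈ U) : ∃ w' : G'.Walk a b, w'.length = w.length := by
  induction w with
  | nil => exact ⟨.nil, rfl⟩
  | @cons a b c h w ih =>
    obtain ⟨w', hw'⟩ := ih fun z hz => hw z (by simp [hz])
    exact ⟨.cons (hG a b (hw a (by simp)) (hw b (by simp)) h) w', by simp [hw']⟩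

theorem exists_closer_neighbor {V : Type*} {G : SimpleGraph V} {v z : V} (h : G.Reachable v z)
    (hz : z ≠ v) : ∃ x, G.Adj x z ∧ G.Reachable v x ∧ G.dist v z = G.dist v x + 1 := by
  obtain ⟨w, hw⟩ := h.symm.exists_walk_length_eq_dist
  cases w with
  | nil => exact absurd rfl hz
  | @cons _ x _ hzx w =>
    refine ⟨x, hzx.symm, ⟨w.reverse⟩, ?_⟩
    rw [SimpleGraph.Walk.length_cons, SimpleGraph.dist_comm] at hw
    have h1 := SimpleGraph.dist_le w.reverse
    rw [SimpleGraph.Walk.length_reverse] at h1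
    obtain ⟨q, hq⟩ := (show G.Reachable v x from ⟨w.reverse⟩).exists_walk_length_eq_dist
    have h2 := SimpleGraph.dist_le (q.concat hzx.symm)
    rw [SimpleGraph.Walk.length_concat] at h2
    omega

/-- Breadth-first search from `v` among the vertices not below `v`. Each strongly reachable vertex
is attached as a leaf to the last vertex before it on a witnessing walk. -/
theorem exists_isParentTree {V : Type*} (G : SimpleGraph V) (L : V → ℕ) (r : ℕ) (v : V) :
    ∃ Z π dep, IsParentTree G r v {z | L v ≤ L z} (SReach G L r v) Z π dep := by
  classical
  let U : Set V := {z | L v ≤ L z}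
  let G' : SimpleGraph V :=
    { Adj := fun a b => G.Adj a b ∧ a ∈ U ∧ b ∈ U
      symm := ⟨fun a b h => ⟨h.1.symm, h.2.2, h.2.1⟩⟩
      loopless := ⟨fun a h => G.irrefl h.1⟩ }
  let Y := SReach G L r v
  have hvY : v ∉ Y := fun h => lt_irrefl _ h.1
  have hYU : ∀ y ∈ Y, y ∉ U := fun y hy hU => absurd hy.1 (not_lt.2 hU)
  have hreachU : ∀ z, G'.Reachable v z → z ∈ U := by
    intro z hz
    by_cases h : z = v
    · rw [h]
      exact le_rfl (a := L v)
    · obtain ⟨x, hx, -⟩ := exists_closer_neighbor hz h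
      exact hx.2.2
  have hY : ∀ y, ∃ p, y ∈ Y → G.Adj p y ∧ G'.Reachable v p ∧ G'.dist v p + 1 ≤ r := by
    intro y
    by_cases hy : y ∈ Y
    · obtain ⟨hlt, w, hw, hs⟩ := hy
      obtain ⟨p, hp, hpy, q, hq, hqU⟩ := exists_last_step (U := U) w
        (fun h => by rw [h] at hlt; exact lt_irrefl _ hlt) hs
      obtain ⟨q', hq'⟩ := exists_walk_of_support_subset (G' := G')
        (fun a b ha hb hab => ⟨hab, ha, hb⟩) q hqU
      have := SimpleGraph.dist_le q'
      exact ⟨p, fun _ => ⟨hpy, ⟨q'⟩, by omega⟩⟩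
    · exact ⟨v, fun h => absurd h hy⟩
  have hZ : ∀ z, ∃ x, G'.Reachable v z → z ≠ v →
      G'.Adj x z ∧ G'.Reachable v x ∧ G'.dist v z = G'.dist v x + 1 := by
    intro z
    by_cases hz : G'.Reachable v z ∧ z ≠ v
    · obtain ⟨x, hx⟩ := exists_closer_neighbor hz.1 hz.2
      exact ⟨x, fun _ _ => hx⟩
    · exact ⟨v, fun h1 h2 => absurd ⟨h1, h2⟩ hz⟩
  choose p hp using hY
  choose q hq using hZ
  refine ⟨{z | z ∈ Y ∨ G'.Reachable v z}, fun z => if z ∈ Y then p z else q z,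
    fun z => if z ∈ Y then G'.dist v (p z) + 1 else G'.dist v z, ?_, ?_, ?_, ?_, hvY, ?_, ?_⟩
  · exact fun z hz => .inl hz
  · exact fun z hz hzY => hreachU z (hz.resolve_left hzY)
  · simp [hvY]
  · intro y hy
    simp only [show y ∈ Y from hy, if_true]
    exact (hp y hy).2.2
  · intro z hz hzv
    by_cases hzY : z ∈ Y
    · obtain ⟨h1, h2, -⟩ := hp z hzY
      have : p z ∉ Y := fun h => hYU _ h (hreachU _ h2)
      simp only [hzY, if_true, this, if_false]
      exact ⟨.inr h2, this, h1, trivial⟩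
    · obtain ⟨h1, h2, h3⟩ := hq z (hz.resolve_left hzY) hzv
      have : q z ∉ Y := fun h => hYU _ h (hreachU _ h2)
      simp only [hzY, this, if_false]
      exact ⟨.inr h2, this, h1.1, h3⟩
  · intro z hz h0
    by_cases hzY : z ∈ Y
    · simp [hzY] at h0
    · simp only [hzY, if_false] at h0
      exact ((hz.resolve_left hzY).dist_eq_zero_iff.1 h0).symm

namespace IsParentTree

variable {V : Type*} {G : SimpleGraph V} {r : ℕ} {v : V} {U Y Z : Set V} {π : V → V}
  {dep : V → ℕ}

/-- The vertices below `c` in a parent tree. -/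
def below (π : V → V) (dep : V → ℕ) (c : V) : Set V :=
  {z | ∃ j, π^[j] z = c ∧ dep z = dep c + j}

theorem disjoint_below {c c' : V} (hd : dep c = dep c') (hne : c ≠ c') :
    Disjoint (below π dep c) (below π dep c') := by
  refine Set.disjoint_left.2 ?_
  rintro z ⟨j, hj, hz⟩ ⟨j', hj', hz'⟩
  have : j = j' := by omega
  subst this
  exact hne (hj.symm.trans hj')

theorem exists_walk_below (T : IsParentTree G r v U Y Z π dep) {c : V} (j : ℕ) (y : V)
    (hy : y ∈ Z) (hj : π^[j] y = c) (hd : dep y = dep c + j) :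
    c ∈ Z ∧ (j ≠ 0 → c ∉ Y) ∧ ∃ w : G.Walk c y, w.length = j ∧
      ∀ z ∈ w.support, z ∈ below π dep c ∧ (z = y ∨ z ∈ U) := by
  induction j generalizing y with
  | zero =>
    have : y = c := hj
    subst this
    exact ⟨hy, by simp, .nil, rfl, by simpa using ⟨0, rfl, rfl⟩⟩
  | succ j ih =>
    have hyv : y ≠ v := by
      rintro rfl
      have := T.depth_root
      omega
    obtain ⟨h1, h2, h3, h4⟩ := T.step y hy hyv
    have hj' : π^[j] (π y) = c := by rw [← Function.iterate_succ_apply, hj]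
    obtain ⟨hc, hcY, w, hw, hs⟩ := ih (π y) h1 hj' (by omega)
    refine ⟨hc, fun _ => ?_, w.concat h3, by simp [hw], ?_⟩
    · rcases Nat.eq_zero_or_pos j with rfl | h
      · have : π y = c := hj'
        rwa [← this]
      · exact hcY h.ne'
    · intro z hz
      rw [SimpleGraph.Walk.support_concat, List.mem_append, List.mem_singleton] at hz
      rcases hz with hz | rfl
      · refine ⟨(hs z hz).1, .inr ?_⟩
        rcases (hs z hz).2 with h | h
        · rw [h]
          exact T.disj _ h1 h2
        · exact h
      · exact ⟨⟨j + 1, hj, hd⟩, .inl rfl⟩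

end IsParentTree

open IsParentTree in
-- The children of `x` that lead to targets span disjoint subtrees and so yield a fan centred at
-- `x`. Admissibility at `x`, not at `v`, therefore bounds the branching by `k`, and `m` levels
-- remain.
theorem card_below_le {V : Type*} [Fintype V] {G : SimpleGraph V} {r k : ℕ} {L : V → ℕ}
    (hL : IsAdmissible G r k L) (hk : 0 < k) {v : V} {Z : Set V} {π : V → V} {dep : V → ℕ}
    (T : IsParentTree G r v {z | L v ≤ L z} (SReach G L r v) Z π dep) (m : ℕ) :
    ∀ x ∈ Z, x ∉ SReach G L r v → dep x + m = r →
      (below π dep x ∩ SReach G L r v).ncard ≤ k ^ m := by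
  classical
  set Y := SReach G L r v with hYdef
  have hYbelow : ∀ x ∈ Z, ∀ y ∈ Y, y ∈ below π dep x → x ∉ Y → ∃ c ∈ Z, π c = x ∧
      dep c = dep x + 1 ∧ y ∈ below π dep c := by
    rintro x hx y hy ⟨j, hj, hd⟩ hxY
    cases j with
    | zero => exact absurd (show y = x from hj ▸ rfl) (fun h => hxY (h ▸ hy))
    | succ j =>
      rw [Function.iterate_succ_apply'] at hj
      have hyj : dep (π^[j] y) = dep x + 1 := by
        have aux : ∀ i ≤ j, π^[i] y ∈ Z ∧ dep (π^[i] y) + i = dep y := by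
          intro i
          induction i with
          | zero => exact fun _ => ⟨T.targets hy, rfl⟩
          | succ i ih =>
            intro hi
            obtain ⟨h1, h2⟩ := ih (by omega)
            have hne : π^[i] y ≠ v := fun h => by
              have := T.depth_root
              rw [h] at h2
              omega
            obtain ⟨h3, -, -, h4⟩ := T.step _ h1 hne
            rw [Function.iterate_succ_apply']
            exact ⟨h3, by omega⟩
        have := (aux j le_rfl).2
        omega
      have hbel : y ∈ below π dep (π^[j] y) := ⟨j, rfl, by omega⟩
      exact ⟨_, (T.exists_walk_below j y (T.targets hy) rfl (by omega)).1, hj, hyj, hbel⟩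
  induction m with
  | zero =>
    intro x hx hxY hdep
    have : below π dep x ∩ Y = ∅ := by
      ext y
      simp only [Set.mem_inter_iff, Set.mem_empty_iff_false, iff_false, not_and]
      intro hy hyY
      obtain ⟨c, -, -, hc, j, -, hj⟩ := hYbelow x hx y hyY hy hxY
      have := T.depth_le y hyY
      omega
    simp [this]
  | succ m ih =>
    intro x hx hxY hdep
    let C : Finset V := Finset.univ.filter fun c => c ∈ Z ∧ π c = x ∧ dep c = dep x + 1 ∧
      (below π dep c ∩ Y).Nonempty
    have hC : ∀ c ∈ C, c ∈ Z ∧ π c = x ∧ dep c = dep x + 1 ∧ (below π dep c ∩ Y).Nonempty := by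
      intro c hc
      simpa [C] using hc
    have hxL : L v ≤ L x := T.disj x hx hxY
    have hCk : C.card ≤ k := by
      by_contra hlt
      obtain ⟨s, hsC, hs⟩ := Finset.exists_subset_card_eq (not_le.1 hlt).le
      apply hL.2 x
      have hch : ∀ c, ∃ t, c ∈ s → t ∈ below π dep c ∧ L t < L x ∧
          Linked G r (below π dep c \ {u | L u ≤ L x}) x t := by
        intro c
        by_cases hc : c ∈ s
        · obtain ⟨hcZ, hπ, hdc, y, ⟨j, hj, hd⟩, hy⟩ := hC c (hsC hc)
          obtain ⟨-, -, w, hw, hws⟩ := T.exists_walk_below j y (T.targets hy) hj hd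
          have hcv : c ≠ v := by
            rintro rfl
            have := T.depth_root
            omega
          have hadj : G.Adj x c := hπ ▸ (T.step c hcZ hcv).2.2.1
          have hyx : L y < L x := lt_of_lt_of_le hy.1 hxL
          -- The target `y` is below `v`, hence below `x`. Stopping at the first vertex below `x`
          -- keeps the interior of the walk above `x`, as a fan requires.
          obtain ⟨t, ht, p, q, hlen, hp, -, hT⟩ :=
            exists_split_walk {u | L u < L x} (SimpleGraph.Walk.cons hadj w) hyx
          have hsupp : ∀ z ∈ p.support, z = x ∨ z ∈ below π dep c := by
            intro z hz
            have := hp hz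
            rw [SimpleGraph.Walk.support_cons, List.mem_cons] at this
            exact this.imp_right fun h => (hws z h).1
          refine ⟨t, fun _ => ⟨?_, ht, p, ?_, ?_⟩⟩
          · rcases hsupp t p.end_mem_support with h | h
            · rw [h] at ht
              exact absurd ht (lt_irrefl (L x))
            · exact h
          · have := T.depth_le y hy
            rw [SimpleGraph.Walk.length_cons] at hlen
            omega
          · intro z hz
            rcases hsupp z hz with h | h
            · exact .inl h
            by_cases hzx : L z ≤ L x
            · rcases hzx.eq_or_lt with h' | h'
              · exact .inl (hL.1 h')
              · exact .inr (.inl (hT z hz h'))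
            · exact .inr (.inr ⟨h, hzx⟩)
        · exact ⟨x, fun h => absurd h hc⟩
      choose t ht using hch
      have hdis : ∀ i ∈ s, ∀ j ∈ s, i ≠ j → Disjoint (below π dep i) (below π dep j) :=
        fun i hi j hj hij => disjoint_below
          ((hC i (hsC hi)).2.2.1.trans (hC j (hsC hj)).2.2.1.symm) hij
      refine ⟨s, t, fun c => below π dep c \ {u | L u ≤ L x}, hs, ?_, ?_, ?_⟩
      · intro i hi j hj hij
        by_contra hne
        exact Set.disjoint_left.1 (hdis i hi j hj hne) (ht i hi).1 (hij ▸ (ht j hj).1)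
      · intro i hi
        refine ⟨(ht i hi).2.1.le, fun h => ?_, Set.disjoint_sdiff_left, (ht i hi).2.2⟩
        have := (ht i hi).2.1
        rw [h] at this
        exact lt_irrefl _ this
      · exact fun i hi j hj hij => (hdis i hi j hj hij).mono Set.sdiff_subset Set.sdiff_subset
    have hcount : ∀ c ∈ C, (below π dep c ∩ Y).toFinset.card ≤ k ^ m := by
      intro c hc
      obtain ⟨hcZ, -, hdc, -⟩ := hC c hc
      rw [← Set.ncard_eq_toFinset_card']
      -- Targets are leaves, so a child that is a target has no other target below it.
      by_cases hcY : c ∈ Y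
      · have : below π dep c ∩ Y ⊆ {c} := by
          rintro y ⟨⟨j, hj, hd⟩, hy⟩
          by_cases h0 : j = 0
          · subst h0
            exact hj
          · exact absurd hcY ((T.exists_walk_below j y (T.targets hy) hj hd).2.1 h0)
        refine (Set.ncard_le_ncard this).trans ?_
        rw [Set.ncard_singleton]
        exact Nat.one_le_pow _ _ hk
      · exact ih c hcZ hcY (by omega)
    have hsub : (below π dep x ∩ Y).toFinset ⊆ C.biUnion fun c => (below π dep c ∩ Y).toFinset := by
      intro y hy
      rw [Set.mem_toFinset] at hy
      obtain ⟨c, hcZ, hπ, hdc, hyc⟩ := hYbelow x hx y hy.2 hy.1 hxY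
      rw [Finset.mem_biUnion]
      exact ⟨c, by simpa [C] using ⟨hcZ, hπ, hdc, y, hyc, hy.2⟩, by simpa using ⟨hyc, hy.2⟩⟩
    rw [Set.ncard_eq_toFinset_card']
    calc _ ≤ _ := Finset.card_le_card hsub
      _ ≤ C.card * k ^ m := Finset.card_biUnion_le_card_mul _ _ _ hcount
      _ ≤ k * k ^ m := Nat.mul_le_mul_right _ hCk
      _ = k ^ (m + 1) := (pow_succ' k m).symm

theorem ncard_SReach_le {V : Type*} [Fintype V] {G : SimpleGraph V} {r k : ℕ} {L : V → ℕ}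
    (hL : IsAdmissible G r k L) (hk : 0 < k) (v : V) : (SReach G L r v).ncard ≤ k ^ r := by
  classical
  obtain ⟨Z, π, dep, T⟩ := exists_isParentTree G L r v
  rcases (SReach G L r v).eq_empty_or_nonempty with h | ⟨y₀, hy₀⟩
  · simp [h]
  have hchain : ∀ n, ∀ z ∈ Z, dep z = n → v ∈ Z ∧ π^[n] z = v := by
    intro n
    induction n with
    | zero =>
      intro z hz h0
      have := T.root_eq z hz h0
      exact ⟨this ▸ hz, this⟩
    | succ n ih =>
      intro z hz hn
      have hzv : z ≠ v := by
        rintro rfl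
        have := T.depth_root
        omega
      obtain ⟨h1, -, -, h4⟩ := T.step z hz hzv
      rw [Function.iterate_succ_apply]
      exact ih _ h1 (by omega)
  have hvZ : v ∈ Z := (hchain _ y₀ (T.targets hy₀) rfl).1
  have hsub : SReach G L r v ⊆ IsParentTree.below π dep v ∩ SReach G L r v := fun y hy =>
    ⟨⟨dep y, (hchain _ y (T.targets hy) rfl).2, by rw [T.depth_root, zero_add]⟩, hy⟩
  exact (Set.ncard_le_ncard hsub).trans
    (card_below_le hL hk T r v hvZ T.root_notMem (by rw [T.depth_root, zero_add]))

/-- A walk witnessing weak reachability first drops below `v` at a strongly reachable vertex, and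
the rest is a shorter witness from there. -/
theorem ncard_WReach_le {V : Type*} [Fintype V] {G : SimpleGraph V} {r N : ℕ} {L : V → ℕ}
    (hL : L.Injective) (hN : ∀ v, (SReach G L r v).ncard ≤ N) (m : ℕ) (hm : m ≤ r) (v : V) :
    (WReach G L m v).ncard ≤ (1 + N) ^ m := by
  classical
  induction m generalizing v with
  | zero =>
    have : WReach G L 0 v ⊆ {v} := by
      rintro y ⟨w, hw, -⟩
      exact (SimpleGraph.Walk.eq_of_length_eq_zero (Nat.le_zero.1 hw)).symm
    simpa using Set.ncard_le_ncard this
  | succ m ih =>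
    have hsub : (WReach G L (m + 1) v).toFinset ⊆
        insert v ((SReach G L r v).toFinset.biUnion fun u => (WReach G L m u).toFinset) := by
      intro y hy
      rw [Set.mem_toFinset] at hy
      obtain ⟨w, hw, hs⟩ := hy
      rw [Finset.mem_insert]
      by_cases hyv : y = v
      · exact .inl hyv
      right
      have hlt : L y < L v :=
        lt_of_le_of_ne (hs v w.start_mem_support) fun h => hyv (hL h)
      obtain ⟨x, hx, p, q, hlen, hp, hq, hT⟩ := exists_split_walk {u | L u < L v} w hlt
      have hplen : p.length ≠ 0 := by
        intro h
        have := SimpleGraph.Walk.eq_of_length_eq_zero h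
        rw [← this] at hx
        exact lt_irrefl (L v) hx
      rw [Finset.mem_biUnion]
      refine ⟨x, ?_, ?_⟩
      · rw [Set.mem_toFinset]
        refine ⟨hx, p, by omega, fun z hz hzx => ?_⟩
        by_contra hlt'
        exact hzx (hT z hz (not_le.1 hlt'))
      · rw [Set.mem_toFinset]
        exact ⟨q, by omega, fun z hz => hs z (hq hz)⟩
    rw [Set.ncard_eq_toFinset_card']
    refine (Finset.card_le_card hsub).trans ((Finset.card_insert_le _ _).trans ?_)
    have h1 := Finset.card_biUnion_le_card_mul (SReach G L r v).toFinset
      (fun u => (WReach G L m u).toFinset) ((1 + N) ^ m) (fun u _ => by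
        rw [← Set.ncard_eq_toFinset_card']
        exact ih (by omega) u)
    have h2 := hN v
    rw [Set.ncard_eq_toFinset_card'] at h2
    have h3 : 1 ≤ (1 + N) ^ m := Nat.one_le_pow _ _ (by omega)
    calc _ ≤ N * (1 + N) ^ m + (1 + N) ^ m :=
          Nat.add_le_add (h1.trans (Nat.mul_le_mul_right _ h2)) h3
      _ = (1 + N) ^ (m + 1) := by ring

/-! ### Covers from orders -/

theorem mem_WReach_of_mem_support {V : Type*} {G : SimpleGraph V} {L : V → ℕ} {r : ℕ} {u w : V}
    (p : G.Walk w u) (hp : p.length ≤ r) (hL : ∀ z ∈ p.support, L u ≤ L z) :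
    ∀ z ∈ p.support, u ∈ WReach G L r z := by
  classical
  intro z hz
  refine ⟨p.dropUntil z hz, (p.length_dropUntil_le_length hz).trans hp, fun y hy => ?_⟩
  exact hL y (p.support_dropUntil_subset_support hz hy)

theorem exists_walk_induce {V : Type*} {G : SimpleGraph V} (s : Set V) {a b : V} (w : G.Walk a b)
    (h : ∀ x ∈ w.support, x ∈ s) (ha : a ∈ s) (hb : b ∈ s) :
    ∃ w' : ((⊤ : G.Subgraph).induce s).coe.Walk ⟨a, ha⟩ ⟨b, hb⟩, w'.length = w.length := by
  induction w with
  | nil => exact ⟨.nil, rfl⟩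
  | @cons a c b hac w ih =>
    have hc : c ∈ s := h c (by simp)
    obtain ⟨w', hw'⟩ := ih (fun x hx => h x (by simp [hx])) hc hb
    exact ⟨.cons (show ((⊤ : G.Subgraph).induce s).coe.Adj ⟨a, ha⟩ ⟨c, hc⟩ by
      simpa using ⟨ha, hc, hac⟩) w', by simp [hw']⟩

/-- The cluster of `u` consists of the vertices that weakly reach `u`. It contains every witnessing
walk, so `u` is a centre, and the number of clusters at `v` is at most the number of vertices that
`v` weakly reaches. -/
theorem exists_cover_of_order {V : Type*} [Fintype V] (G : SimpleGraph V) {L : V → ℕ}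
    (r D : ℕ) (hD : ∀ v, (WReach G L (2 * r) v).ncard ≤ D) :
    ∃ 𝒳 : Set G.Subgraph, IsNbhdCover G r 𝒳 ∧ coverRadius 𝒳 ≤ ((2 * r : ℕ) : ℕ∞) ∧
      coverDegree 𝒳 ≤ D := by
  classical
  let K : V → Set V := fun u => {w | u ∈ WReach G L (2 * r) w}
  let X : V → G.Subgraph := fun u => (⊤ : G.Subgraph).induce (K u)
  have huK : ∀ u, u ∈ K u := fun u => ⟨.nil, by simp, by simp⟩
  have hwalk : ∀ u (w : V) (hw : w ∈ K u), ∃ p : (X u).coe.Walk ⟨w, hw⟩ ⟨u, huK u⟩,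
      p.length ≤ 2 * r := by
    rintro u w ⟨p, hp, hL⟩
    obtain ⟨p', hp'⟩ := exists_walk_induce (K u) p (mem_WReach_of_mem_support p hp hL) ⟨p, hp, hL⟩ (huK u)
    exact ⟨p', by omega⟩
  refine ⟨Set.range X, ⟨?_, ?_⟩, ?_, ?_⟩
  · rintro _ ⟨u, rfl⟩
    rw [SimpleGraph.Subgraph.connected_iff']
    refine SimpleGraph.connected_iff_exists_forall_reachable _ |>.2 ⟨⟨u, huK u⟩, ?_⟩
    rintro ⟨w, hw⟩
    obtain ⟨p, -⟩ := hwalk u w hw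
    exact ⟨p.reverse⟩
  · intro v
    have hball : ∀ w ∈ nbhd G r v, ∃ p : G.Walk v w, p.length ≤ r := by
      intro w hw
      have hw' : G.edist v w ≤ r := hw
      obtain ⟨p, hp⟩ := SimpleGraph.exists_walk_of_edist_ne_top
        (ne_top_of_le_ne_top (ENat.natCast_ne_top r) hw')
      rw [← hp] at hw'
      exact ⟨p, by exact_mod_cast hw'⟩
    -- The least vertex `u` of the ball is weakly reached from each vertex of the ball by a walk
    -- through `v` of length at most `2 * r`.
    obtain ⟨u, hu, hmin⟩ := (Set.toFinite (nbhd G r v)).exists_minimalFor L _ ⟨v, by simp [nbhd]⟩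
    have hmin' : ∀ w ∈ nbhd G r v, L u ≤ L w := fun w hw => by
      rcases le_total (L u) (L w) with h | h
      · exact h
      · exact hmin hw h
    refine ⟨X u, ⟨u, rfl⟩, fun w hw => ?_⟩
    obtain ⟨p, hp⟩ := hball w hw
    obtain ⟨q, hq⟩ := hball u hu
    have hsup : ∀ {x} (p : G.Walk v x), p.length ≤ r → ∀ z ∈ p.support, z ∈ nbhd G r v := by
      intro x p hp z hz
      have := SimpleGraph.edist_le (p.takeUntil z hz)
      refine this.trans ?_
      exact_mod_cast (p.length_takeUntil_le_length hz).trans hp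
    refine ⟨p.reverse.append q, ?_, fun z hz => hmin' z ?_⟩
    · rw [SimpleGraph.Walk.length_append, SimpleGraph.Walk.length_reverse]
      omega
    · rw [SimpleGraph.Walk.mem_support_append_iff, SimpleGraph.Walk.support_reverse,
        List.mem_reverse] at hz
      rcases hz with hz | hz
      · exact hsup p hp z hz
      · exact hsup q hq z hz
  · refine iSup₂_le ?_
    rintro _ ⟨u, rfl⟩
    refine SimpleGraph.radius_le_eccent (u := ⟨u, huK u⟩) |>.trans ?_
    rw [SimpleGraph.eccent_le_iff]
    rintro ⟨w, hw⟩
    obtain ⟨p, hp⟩ := hwalk u w hw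
    rw [SimpleGraph.edist_comm]
    exact (SimpleGraph.edist_le p).trans (by exact_mod_cast hp)
  · rcases isEmpty_or_nonempty V with hV | hV
    · simp [coverDegree]
    refine ciSup_le fun v => (le_trans ?_ (hD v))
    have : {Y ∈ Set.range X | v ∈ Y.verts} ⊆ X '' WReach G L (2 * r) v := by
      rintro _ ⟨⟨u, rfl⟩, hv⟩
      exact ⟨u, hv, rfl⟩
    exact (Set.ncard_le_ncard this).trans (Set.ncard_image_le (Set.toFinite _))

theorem exists_cover_of_topGrad_le {V : Type*} [Finite V] (G : SimpleGraph V) (r d : ℕ)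
    (hd : topGrad (2 * r) G ≤ d) :
    ∃ 𝒳 : Set G.Subgraph, IsNbhdCover G r 𝒳 ∧ coverRadius 𝒳 ≤ ((2 * r : ℕ) : ℕ∞) ∧
      coverDegree 𝒳 ≤
        (1 + (2 * d * (1 + (2 * (2 * r) + 1) * d) * (4 * d + 1) + 1) ^ (2 * r)) ^ (2 * r) := by
  have := Fintype.ofFinite V
  obtain ⟨L, hL⟩ := exists_isAdmissible (G := G) fun A hA =>
    exists_not_hasFan hd (Nat.lt_succ_self _) hA
  exact exists_cover_of_order G r _ fun v =>
    ncard_WReach_le hL.1 (fun v => ncard_SReach_le hL (Nat.succ_pos _) v) (2 * r) le_rfl v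

/-! ### Nowhere dense classes admit sparse covers -/

theorem exists_le_rpow (c ε : ℝ) (hε : 0 < ε) : ∃ n₀ : ℕ, ∀ n : ℕ, n₀ ≤ n → c ≤ (n : ℝ) ^ ε := by
  have h := ((tendsto_rpow_atTop hε).comp tendsto_natCast_atTop_atTop).eventually_ge_atTop c
  exact Filter.eventually_atTop.1 h

theorem exists_poly_bound (r : ℕ) : ∃ c p : ℕ, ∀ d : ℕ, 1 ≤ d →
    (1 + (2 * d * (1 + (2 * (2 * r) + 1) * d) * (4 * d + 1) + 1) ^ (2 * r)) ^ (2 * r) ≤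
      c * d ^ p := by
  refine ⟨(2 * (20 * r * 2 + 21) ^ (2 * r)) ^ (2 * r), 3 * (2 * r) * (2 * r), fun d hd => ?_⟩
  have h1 : 2 * d * (1 + (2 * (2 * r) + 1) * d) * (4 * d + 1) + 1 ≤ (20 * r * 2 + 21) * d ^ 3 := by
    have h2 : 1 + (2 * (2 * r) + 1) * d ≤ (4 * r + 2) * d := by nlinarith
    have h3 : 4 * d + 1 ≤ 5 * d := by omega
    have h4 : 1 ≤ d ^ 3 := Nat.one_le_pow _ _ hd
    calc _ ≤ 2 * d * ((4 * r + 2) * d) * (5 * d) + d ^ 3 := by gcongr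
      _ = (20 * r * 2 + 21) * d ^ 3 := by ring
  have h5 : 1 ≤ ((20 * r * 2 + 21) * d ^ 3) ^ (2 * r) :=
    Nat.one_le_pow _ _ (Nat.mul_pos (by omega) (Nat.pow_pos hd))
  calc _ ≤ (((20 * r * 2 + 21) * d ^ 3) ^ (2 * r) + ((20 * r * 2 + 21) * d ^ 3) ^ (2 * r)) ^
        (2 * r) := by gcongr
    _ = _ := by
      rw [← two_mul, mul_pow (20 * r * 2 + 21), ← mul_assoc, mul_pow (2 * _), ← pow_mul, ← pow_mul,
        Nat.mul_assoc 3]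

theorem admitsSparseCovers_of_isNowhereDense {C : Set FinGraph.{u}} (hC : IsNowhereDense C) :
    AdmitsSparseCovers C := by
  intro r
  refine ⟨2, fun ε hε => ?_⟩
  obtain ⟨c, p, hcp⟩ := exists_poly_bound r
  -- With this exponent the `p`-th power of `n ^ δ` is at most `n ^ (ε / 2)`; the other half of `ε`
  -- absorbs the constants.
  have hδ : 0 < ε / (2 * (p + 1)) := by positivity
  obtain ⟨n₁, hn₁⟩ := hC _ hδ (2 * r)
  obtain ⟨n₂, hn₂⟩ := exists_le_rpow (c * 2 ^ p) (ε / 2) (by positivity)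
  refine ⟨max (max n₁ n₂) 1, fun G hG hn => ?_⟩
  set n := G.order with hndef
  have hn1 : (1 : ℝ) ≤ n := by exact_mod_cast (le_max_right _ _).trans hn
  set δ := ε / (2 * ((p : ℝ) + 1)) with hδdef
  set d := ⌈(n : ℝ) ^ δ⌉₊ with hd
  have hnδ : (1 : ℝ) ≤ (n : ℝ) ^ δ := Real.one_le_rpow hn1 hδ.le
  have hd1 : 1 ≤ d := Nat.one_le_ceil_iff.2 (by linarith)
  have hd2 : (d : ℝ) ≤ 2 * (n : ℝ) ^ δ := by
    have := Nat.ceil_lt_add_one (show 0 ≤ (n : ℝ) ^ δ by linarith)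
    linarith
  obtain ⟨𝒳, h1, h2, h3⟩ := exists_cover_of_topGrad_le G.graph r d
    ((hn₁ G hG (by omega)).trans (Nat.le_ceil _))
  refine ⟨𝒳, h1, h2, ?_⟩
  have h4 : (coverDegree 𝒳 : ℝ) ≤ c * (d : ℝ) ^ p := by exact_mod_cast h3.trans (hcp d hd1)
  refine h4.trans ?_
  have h5 : ((n : ℝ) ^ δ) ^ p ≤ (n : ℝ) ^ (ε / 2) := by
    rw [← Real.rpow_natCast, ← Real.rpow_mul (by linarith)]
    refine Real.rpow_le_rpow_of_exponent_le hn1 ?_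
    rw [hδdef, div_mul_eq_mul_div, div_le_div_iff₀ (by positivity) (by positivity)]
    nlinarith
  calc (c : ℝ) * (d : ℝ) ^ p ≤ c * (2 * (n : ℝ) ^ δ) ^ p := by gcongr
    _ = c * 2 ^ p * ((n : ℝ) ^ δ) ^ p := by rw [mul_pow]; ring
    _ ≤ (n : ℝ) ^ (ε / 2) * (n : ℝ) ^ (ε / 2) := by
      gcongr
      exact hn₂ n (by omega)
    _ = (n : ℝ) ^ ε := by
      rw [← Real.rpow_add (by linarith)]
      congr 1
      ring

/-! ### Almost regular subgraphs -/

open Classical in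
/-- The number of ordered pairs in `S × T` that are adjacent. -/
noncomputable def adjCount {V : Type*} (H : SimpleGraph V) (S T : Finset V) : ℕ :=
  ∑ x ∈ S, ∑ y ∈ T, if H.Adj x y then 1 else 0

section adjCount

variable {V : Type*} {H : SimpleGraph V}

theorem adjCount_comm (S T : Finset V) : adjCount H S T = adjCount H T S := by
  rw [adjCount, Finset.sum_comm]
  exact Finset.sum_congr rfl fun y _ => Finset.sum_congr rfl fun x _ => by rw [H.adj_comm]

theorem adjCount_union_left [DecidableEq V] {S S' : Finset V} (h : Disjoint S S') (T : Finset V) :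
    adjCount H (S ∪ S') T = adjCount H S T + adjCount H S' T :=
  Finset.sum_union h

theorem adjCount_union_right [DecidableEq V] (S : Finset V) {T T' : Finset V}
    (h : Disjoint T T') : adjCount H S (T ∪ T') = adjCount H S T + adjCount H S T' := by
  rw [adjCount_comm, adjCount_union_left h, adjCount_comm T, adjCount_comm T']

theorem adjCount_mono {S S' T T' : Finset V} (h : S ⊆ S') (h' : T ⊆ T') :
    adjCount H S T ≤ adjCount H S' T' :=
  (Finset.sum_le_sum fun _ _ => Finset.sum_le_sum_of_subset h').trans
    (Finset.sum_le_sum_of_subset h)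

theorem adjCount_eq_sum_singleton (S T : Finset V) :
    adjCount H S T = ∑ x ∈ S, adjCount H {x} T := by
  simp [adjCount]

theorem adjCount_le_mul (S T : Finset V) : adjCount H S T ≤ S.card * T.card := by
  classical
  calc adjCount H S T ≤ ∑ x ∈ S, ∑ y ∈ T, 1 :=
        Finset.sum_le_sum fun _ _ => Finset.sum_le_sum fun _ _ => by split_ifs <;> simp
    _ = _ := by simp

theorem adjCount_singleton (x : V) (T : Finset V) :
    adjCount H {x} T = (H.neighborSet x ∩ T).ncard := by
  classical
  have : H.neighborSet x ∩ T = ((T.filter fun y => H.Adj x y : Finset V) : Set V) := by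
    ext y
    simp [and_comm]
  rw [this, Set.ncard_coe_finset, adjCount, Finset.sum_singleton, Finset.card_filter]

theorem adjCount_univ [Fintype V] :
    adjCount H Finset.univ Finset.univ = 2 * H.edgeSet.ncard := by
  classical
  rw [← SimpleGraph.coe_edgeFinset, Set.ncard_coe_finset, ← H.sum_degrees_eq_twice_card_edges,
    adjCount_eq_sum_singleton]
  refine Finset.sum_congr rfl fun x _ => ?_
  rw [adjCount_singleton, Finset.coe_univ, Set.inter_univ, Set.ncard_eq_toFinset_card']
  rfl

theorem ncard_neighborSet_induce (S : Finset V) (x : S) :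
    ((H.induce (S : Set V)).neighborSet x).ncard = adjCount H {x.1} S := by
  rw [adjCount_singleton, ← Set.ncard_image_of_injective _ Subtype.val_injective]
  congr 1
  ext y
  simp only [Set.mem_image, SimpleGraph.mem_neighborSet, SimpleGraph.comap_adj, Set.mem_inter_iff]
  constructor
  · rintro ⟨z, hz, rfl⟩
    exact ⟨hz, z.2⟩
  · rintro ⟨h1, h2⟩
    exact ⟨⟨y, h2⟩, h1, rfl⟩

end adjCount

/-- Pigeonhole: among at most `q` blocks of size at most `b` that partition `T`, the heaviest one is
taken. -/
theorem exists_heavy_subset {V : Type*} (f : V → ℕ) (q b : ℕ) (T : Finset V)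
    (hT : T.card ≤ q * b) : ∃ B ⊆ T, B.card ≤ b ∧ ∑ x ∈ T, f x ≤ q * ∑ x ∈ B, f x := by
  classical
  induction q generalizing T with
  | zero =>
    have : T = ∅ := Finset.card_eq_zero.1 (by omega)
    subst this
    exact ⟨∅, by simp⟩
  | succ q ih =>
    by_cases hTb : T.card ≤ b
    · exact ⟨T, subset_rfl, hTb, Nat.le_mul_of_pos_left _ (Nat.succ_pos q)⟩
    obtain ⟨B₀, hB₀, hb⟩ := Finset.exists_subset_card_eq (not_le.1 hTb).le
    have hsum := Finset.sum_sdiff (f := f) hB₀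
    obtain ⟨B, hB, hBb, hle⟩ := ih (T \ B₀) (by
      rw [Finset.card_sdiff_of_subset hB₀, hb, Nat.sub_le_iff_le_add]
      exact hT.trans (by rw [Nat.succ_mul]))
    rcases le_total (∑ x ∈ B, f x) (∑ x ∈ B₀, f x) with h | h
    · refine ⟨B₀, hB₀, hb.le, ?_⟩
      have := Nat.mul_le_mul_left q h
      rw [Nat.succ_mul]
      omega
    · refine ⟨B, hB.trans Finset.sdiff_subset, hBb, ?_⟩
      rw [Nat.succ_mul]
      omega

/-- A graph of large average degree has a subgraph of large average degree whose maximum degree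
is at most a constant factor larger. -/
theorem exists_almost_regular {α : ℝ} (hα : 0 < α) : ∃ q : ℕ, 0 < q ∧
    ∀ {V : Type*} [Fintype V] [Nonempty V] (H : SimpleGraph V) (D : ℝ),
      D * Fintype.card V ≤ adjCount H Finset.univ Finset.univ →
      q * (Fintype.card V : ℝ) ^ α ≤ D →
      ∃ S : Finset V, S.Nonempty ∧ ∃ d : ℝ, D / (Fintype.card V : ℝ) ^ α ≤ d ∧
        d / 2 * S.card ≤ adjCount H S S ∧ ∀ x ∈ S, (adjCount H {x} S : ℝ) ≤ q * d := by
  classical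
  obtain ⟨q₀, hq₀⟩ := exists_le_rpow (2 * 3 ^ (1 + α)) α hα
  obtain ⟨q, hqα, hq1⟩ : ∃ q : ℕ, 2 * 3 ^ (1 + α) ≤ (q : ℝ) ^ α ∧ 1 ≤ q :=
    ⟨max q₀ 1, hq₀ _ (le_max_left _ _), le_max_right _ _⟩
  refine ⟨q, hq1, ?_⟩
  have hq0 : (0 : ℝ) < q := by exact_mod_cast hq1
  intro V _ _ H D hD hDq
  -- As in the regularisation of Erdős and Simonovits, `S` maximises the edge count relative to `|S|
  -- ^ (1 + α)`, so small subsets carry disproportionately few edges.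
  obtain ⟨S, hS, hmax⟩ := Finset.exists_max_image (Finset.univ.filter fun S : Finset V => S.Nonempty)
    (fun S => (adjCount H S S : ℝ) / (S.card : ℝ) ^ (1 + α)) ⟨Finset.univ, by simp⟩
  simp only [Finset.mem_filter, Finset.mem_univ, true_and] at hS hmax
  obtain ⟨v, hv⟩ : ∃ v : ℝ, v = S.card := ⟨_, rfl⟩
  obtain ⟨e, he⟩ : ∃ e : ℝ, e = adjCount H S S := ⟨_, rfl⟩
  rw [← hv, ← he] at hmax
  obtain ⟨M, hM⟩ : ∃ M : ℝ, M = e / v ^ (1 + α) := ⟨_, rfl⟩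
  rw [← hM] at hmax
  have hv1 : 1 ≤ v := by rw [hv]; exact_mod_cast hS.card_pos
  have hv0 : 0 < v := by linarith
  have hVpos : (0 : ℝ) < Fintype.card V := by exact_mod_cast Fintype.card_pos
  have hMD : D / (Fintype.card V : ℝ) ^ α ≤ M := by
    refine le_trans ?_ (hmax Finset.univ Finset.univ_nonempty)
    rw [Finset.card_univ, div_le_div_iff₀ (Real.rpow_pos_of_pos hVpos _)
      (Real.rpow_pos_of_pos hVpos _), Real.rpow_add hVpos, Real.rpow_one, ← mul_assoc]
    exact mul_le_mul_of_nonneg_right hD (Real.rpow_nonneg hVpos.le _)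
  have hMq : (q : ℝ) ≤ M := ((le_div_iff₀ (by positivity)).2 hDq).trans hMD
  have hM0 : 0 < M := by linarith
  have heM : e = M * v ^ (1 + α) := by rw [hM]; field_simp
  have hbound : ∀ B : Finset V, (adjCount H B B : ℝ) ≤ M * (B.card : ℝ) ^ (1 + α) := by
    intro B
    rcases B.eq_empty_or_nonempty with rfl | hB
    · simp only [adjCount, Finset.sum_empty, Nat.cast_zero]
      exact mul_nonneg hM0.le (Real.rpow_nonneg (Nat.cast_nonneg _) _)
    · have := hmax B hB
      rwa [div_le_iff₀ (Real.rpow_pos_of_pos (Nat.cast_pos.2 hB.card_pos) _)] at this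
  obtain ⟨d, hd⟩ : ∃ d : ℝ, d = e / v := ⟨_, rfl⟩
  have hed : e = d * v := by rw [hd]; field_simp
  have hdM : M ≤ d := by
    have : d = M * v ^ α := by
      rw [hd, heM, Real.rpow_add hv0, Real.rpow_one]
      field_simp
    rw [this]
    exact le_mul_of_one_le_right hM0.le (Real.one_le_rpow hv1 hα.le)
  have hd0 : 0 < d := by linarith
  have hdv : d ≤ v := by
    rw [hd, div_le_iff₀ hv0, he, hv]
    exact_mod_cast adjCount_le_mul S S
  have hqv : (q : ℝ) ≤ v := by linarith
  let A : Finset V := S.filter fun x => q * d < adjCount H {x} S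
  have hAS : A ⊆ S := Finset.filter_subset _ _
  have hAq : (A.card : ℝ) * q ≤ v := by
    have h1 : (A.card : ℝ) * (q * d) ≤ e := by
      calc (A.card : ℝ) * (q * d) = ∑ x ∈ A, q * d := by simp
        _ ≤ ∑ x ∈ A, (adjCount H {x} S : ℝ) :=
          Finset.sum_le_sum fun x hx => (Finset.mem_filter.1 hx).2.le
        _ ≤ ∑ x ∈ S, (adjCount H {x} S : ℝ) :=
          Finset.sum_le_sum_of_subset_of_nonneg hAS fun _ _ _ => Nat.cast_nonneg _
        _ = e := by rw [he, adjCount_eq_sum_singleton]; push_cast; rfl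
    rw [hed, ← mul_assoc, mul_comm d] at h1
    exact le_of_mul_le_mul_right h1 hd0
  let T : Finset V := S \ A
  have hdisj : Disjoint A T := Finset.disjoint_sdiff
  have hunion : A ∪ T = S := Finset.union_sdiff_of_subset hAS
  -- `A`, the vertices of too large degree, has at most `v / q` elements. The block `B` has about
  -- the same size and carries a `1 / q` share of the adjacencies between `A` and `T`.
  obtain ⟨B, hBT, hBcard, hBsum⟩ := exists_heavy_subset (fun x => adjCount H {x} A) q
    (S.card / q + 1) T (by
      have h1 : T.card ≤ S.card := Finset.card_le_card Finset.sdiff_subset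
      have h2 := Nat.lt_mul_div_succ S.card hq1
      omega)
  rw [← adjCount_eq_sum_singleton, ← adjCount_eq_sum_singleton] at hBsum
  have hAB : Disjoint A B := hdisj.mono_right hBT
  have hcardAB : ((A ∪ B).card : ℝ) ≤ 3 * v / q := by
    have h1 : ((A ∪ B).card : ℝ) ≤ A.card + B.card := by exact_mod_cast Finset.card_union_le _ _
    have h2 : (B.card : ℝ) ≤ v / q + 1 := by
      have : (B.card : ℝ) ≤ ((S.card / q : ℕ) : ℝ) + 1 := by exact_mod_cast hBcard
      have h3 : ((S.card / q : ℕ) : ℝ) ≤ v / q := hv ▸ Nat.cast_div_le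
      linarith
    have h3 : (A.card : ℝ) ≤ v / q := (le_div_iff₀ hq0).2 hAq
    have h4 : 1 ≤ v / q := (one_le_div hq0).2 hqv
    have h5 : 3 * v / q = v / q + v / q + v / q := by ring
    linarith
  have hES : adjCount H S S = adjCount H A A + 2 * adjCount H T A + adjCount H T T := by
    rw [← hunion, adjCount_union_left hdisj, adjCount_union_right _ hdisj,
      adjCount_union_right _ hdisj, adjCount_comm A T]
    ring
  have hEAB : adjCount H (A ∪ B) (A ∪ B) =
      adjCount H A A + 2 * adjCount H B A + adjCount H B B := by
    rw [adjCount_union_left hAB, adjCount_union_right _ hAB,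
      adjCount_union_right _ hAB, adjCount_comm A B]
    ring
  have htouch : adjCount H A A + 2 * adjCount H T A ≤ q * adjCount H (A ∪ B) (A ∪ B) := by
    rw [hEAB]
    nlinarith [Nat.zero_le (adjCount H A A), Nat.zero_le (adjCount H B B)]
  -- By extremality a set with a `3 / q` share of the vertices has at most a `(3 / q) ^ (1 + α)`
  -- share of `e`; the choice of `q` makes `q` times this at most one half. So deleting `A` costs at
  -- most half of the edges.
  have hhalf : (q : ℝ) * adjCount H (A ∪ B) (A ∪ B) ≤ e / 2 := by
    have h1 : (adjCount H (A ∪ B) (A ∪ B) : ℝ) ≤ M * (3 * v / q) ^ (1 + α) :=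
      (hbound _).trans (mul_le_mul_of_nonneg_left
        (Real.rpow_le_rpow (Nat.cast_nonneg _) hcardAB (by linarith)) hM0.le)
    have h2 : (q : ℝ) * (M * (3 * v / q) ^ (1 + α)) = e * (3 ^ (1 + α) / (q : ℝ) ^ α) := by
      rw [Real.div_rpow (mul_nonneg zero_le_three hv0.le) hq0.le, Real.mul_rpow zero_le_three hv0.le, heM,
        Real.rpow_add hq0, Real.rpow_one]
      field_simp
    have h3 : (3 : ℝ) ^ (1 + α) / (q : ℝ) ^ α ≤ 1 / 2 := by
      rw [div_le_div_iff₀ (by positivity) (by norm_num)]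
      linarith
    have he0 : 0 ≤ e := by rw [hed]; positivity
    calc (q : ℝ) * adjCount H (A ∪ B) (A ∪ B) ≤ q * (M * (3 * v / q) ^ (1 + α)) := by gcongr
      _ = e * (3 ^ (1 + α) / (q : ℝ) ^ α) := h2
      _ ≤ e * (1 / 2) := by gcongr
      _ = e / 2 := by ring
  have hTT : d / 2 * v ≤ adjCount H T T := by
    have h1 : e = adjCount H A A + 2 * adjCount H T A + adjCount H T T := by
      rw [he, hES]; push_cast; rfl
    have h2 : (adjCount H A A + 2 * adjCount H T A : ℝ) ≤ q * adjCount H (A ∪ B) (A ∪ B) := by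
      exact_mod_cast htouch
    linarith
  refine ⟨T, ?_, d, hMD.trans hdM, ?_, ?_⟩
  · by_contra hne
    rw [Finset.not_nonempty_iff_eq_empty] at hne
    rw [hne] at hTT
    simp only [adjCount, Finset.sum_empty, Nat.cast_zero] at hTT
    have : 0 < d / 2 * v := by positivity
    linarith
  · refine le_trans ?_ hTT
    have : (T.card : ℝ) ≤ v := by
      rw [hv]
      exact_mod_cast Finset.card_le_card Finset.sdiff_subset
    gcongr
  · intro x hx
    have hx' := Finset.mem_sdiff.1 hx
    have h1 : ¬ (q * d < adjCount H {x} S) := fun h => hx'.2 (Finset.mem_filter.2 ⟨hx'.1, h⟩)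
    have h2 : (adjCount H {x} T : ℝ) ≤ adjCount H {x} S := by
      exact_mod_cast adjCount_mono subset_rfl Finset.sdiff_subset
    linarith

/-! ### Subgraphs of large girth -/

theorem ncard_setOf_walk_le {V : Type*} [Fintype V] {F : SimpleGraph V} {D : ℕ}
    (hD : ∀ x, (F.neighborSet x).ncard ≤ D) (l : ℕ) (x : V) :
    {y | ∃ w : F.Walk x y, w.length ≤ l}.ncard ≤ (D + 1) ^ l := by
  classical
  induction l generalizing x with
  | zero =>
    have : {y | ∃ w : F.Walk x y, w.length ≤ 0} ⊆ {x} := by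
      rintro y ⟨w, hw⟩
      exact (SimpleGraph.Walk.eq_of_length_eq_zero (Nat.le_zero.1 hw)).symm
    exact (Set.ncard_le_ncard this).trans (by simp)
  | succ l ih =>
    have hsub : {y | ∃ w : F.Walk x y, w.length ≤ l + 1}.toFinset ⊆
        (insert x (F.neighborSet x).toFinset).biUnion
          fun z => {y | ∃ w : F.Walk z y, w.length ≤ l}.toFinset := by
      intro y hy
      obtain ⟨w, hw⟩ := Set.mem_toFinset.1 hy
      rw [Finset.mem_biUnion]
      cases w with
      | nil => exact ⟨x, by simp, Set.mem_toFinset.2 ⟨.nil, by simp⟩⟩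
      | @cons _ z _ h w =>
        rw [SimpleGraph.Walk.length_cons] at hw
        exact ⟨z, by simp [h], Set.mem_toFinset.2 ⟨w, by omega⟩⟩
    rw [Set.ncard_eq_toFinset_card']
    refine (Finset.card_le_card hsub).trans
      ((Finset.card_biUnion_le_card_mul _ _ ((D + 1) ^ l) fun z _ => ?_).trans ?_)
    · rw [← Set.ncard_eq_toFinset_card']
      exact ih z
    · have := hD x
      rw [Set.ncard_eq_toFinset_card'] at this
      rw [pow_succ']
      exact Nat.mul_le_mul_right _ ((Finset.card_insert_le _ _).trans (by omega))

/-- A cycle through the new edge is split at `x` and `y` into two edge-disjoint arcs; one of them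
avoids the edge and is a walk in `F`, hence long. -/
theorem length_gt_of_isCycle_sup_edge {V : Type*} {F : SimpleGraph V} {g : ℕ}
    (hF : ∀ (v : V) (c : F.Walk v v), c.IsCycle → g < c.length) {x y : V}
    (hxy : ∀ w : F.Walk x y, g < w.length) (v : V) (c : (F ⊔ SimpleGraph.edge x y).Walk v v)
    (hc : c.IsCycle) : g < c.length := by
  classical
  have htrans : ∀ {a b : V} (p : (F ⊔ SimpleGraph.edge x y).Walk a b), s(x, y) ∉ p.edges →
      ∀ e ∈ p.edges, e ∈ F.edgeSet := by
    intro a b p hp e he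
    have he' := p.edges_subset_edgeSet he
    rw [SimpleGraph.edgeSet_sup] at he'
    rcases he' with h | h
    · exact h
    · have h' : e = s(x, y) := SimpleGraph.edgeSet_edge_subset h
      exact absurd (h' ▸ he) hp
  by_cases he : s(x, y) ∈ c.edges
  · have hx : x ∈ c.support := c.fst_mem_support_of_mem_edges he
    set c' := c.rotate x hx with hc'def
    have hc' : c'.IsCycle := SimpleGraph.Walk.isCycle_rotate hx |>.2 hc
    have he' : s(x, y) ∈ c'.edges := (c.rotate_edges x hx).mem_iff.2 he
    have hlen : c'.length = c.length := c.length_rotate x hx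
    have hy : y ∈ c'.support := c'.snd_mem_support_of_mem_edges he'
    have hdis := hc'.isTrail.disjoint_edges_takeUntil_dropUntil hy
    by_cases h1 : s(x, y) ∈ (c'.takeUntil y hy).edges
    · have h2 : s(x, y) ∉ (c'.dropUntil y hy).edges := fun h => hdis h1 h
      have := hxy ((c'.dropUntil y hy).transfer F (htrans _ h2)).reverse
      rw [SimpleGraph.Walk.length_reverse, SimpleGraph.Walk.length_transfer] at this
      have := c'.length_dropUntil_le_length hy
      omega
    · have := hxy ((c'.takeUntil y hy).transfer F (htrans _ h1))
      rw [SimpleGraph.Walk.length_transfer] at this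
      have := c'.length_takeUntil_le_length hy
      omega
  · have := hF v (c.transfer F (htrans c he)) (hc.transfer (htrans c he))
    rwa [SimpleGraph.Walk.length_transfer] at this

/-- `F` is maximal among subgraphs with no cycle of length at most `g` and maximum degree at most
`D`. Every edge of `H` then joins vertices at distance at most `g` in `F` or has an end of full
degree `D`. Pairs of the first kind are few, so there must be many vertices of full degree. -/
theorem exists_high_girth_subgraph {V : Type*} [Fintype V] (H : SimpleGraph V) {g D q : ℕ}
    {d : ℝ} (hg : 1 ≤ g) (hd : 0 < d)
    (hE : d / 2 * Fintype.card V ≤ ∑ x, ((H.neighborSet x).ncard : ℝ))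
    (hΔ : ∀ x, ((H.neighborSet x).ncard : ℝ) ≤ q * d) (hDg : ((D : ℝ) + 1) ^ g ≤ d / 4) :
    ∃ F ≤ H, (∀ (v : V) (c : F.Walk v v), c.IsCycle → g < c.length) ∧
      (Fintype.card V : ℝ) * D ≤ 8 * q * ∑ x, ((F.neighborSet x).ncard : ℝ) := by
  classical
  obtain ⟨F, ⟨hFH, hgirth, hdeg⟩, hmax⟩ :=
    (Set.toFinite {F : SimpleGraph V | F ≤ H ∧
      (∀ (v : V) (c : F.Walk v v), c.IsCycle → g < c.length) ∧
      ∀ x, (F.neighborSet x).ncard ≤ D}).exists_maximal ⟨⊥, bot_le,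
        fun v c hc => absurd rfl (hc.ne_bot), fun x => by simp⟩
  refine ⟨F, hFH, hgirth, ?_⟩
  have hkey : ∀ x y, H.Adj x y → (∃ w : F.Walk x y, w.length ≤ g) ∨
      (F.neighborSet x).ncard = D ∨ (F.neighborSet y).ncard = D := by
    intro x y hxy
    by_contra! hcon
    obtain ⟨h1, h2, h3⟩ := hcon
    have hadj : ¬ F.Adj x y := fun h => by
      have := h1 (.cons h .nil)
      simp at this
      omega
    apply hadj
    have hle : F ⊔ SimpleGraph.edge x y ≤ F := by
      refine hmax ⟨sup_le hFH (SimpleGraph.edge_le_iff _ |>.2 (.inr hxy)),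
        length_gt_of_isCycle_sup_edge hgirth h1, fun z => ?_⟩ le_sup_left
      have hstep : ∀ a b, (F.neighborSet a).ncard ≠ D → (∀ c, (F ⊔ SimpleGraph.edge x y).Adj a c →
          c = b ∨ F.Adj a c) → ((F ⊔ SimpleGraph.edge x y).neighborSet a).ncard ≤ D := by
        intro a b ha hsub
        have : (F ⊔ SimpleGraph.edge x y).neighborSet a ⊆ insert b (F.neighborSet a) :=
          fun c hc => hsub c hc
        refine (Set.ncard_le_ncard this).trans ((Set.ncard_insert_le _ _).trans ?_)
        have := hdeg a
        omega
      by_cases hzx : z = x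
      · subst hzx
        refine hstep z y h2 fun c hc => ?_
        rw [SimpleGraph.sup_adj, SimpleGraph.edge_adj] at hc
        rcases hc with hc | ⟨⟨-, rfl⟩ | ⟨rfl, rfl⟩, hne⟩
        · exact .inr hc
        · exact .inl rfl
        · exact absurd rfl hne
      by_cases hzy : z = y
      · subst hzy
        refine hstep z x h3 fun c hc => ?_
        rw [SimpleGraph.sup_adj, SimpleGraph.edge_adj] at hc
        rcases hc with hc | ⟨⟨rfl, rfl⟩ | ⟨-, rfl⟩, hne⟩
        · exact .inr hc
        · exact absurd rfl hne
        · exact .inl rfl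
      · have : (F ⊔ SimpleGraph.edge x y).neighborSet z = F.neighborSet z := by
          ext c
          simp only [SimpleGraph.mem_neighborSet, SimpleGraph.sup_adj, SimpleGraph.edge_adj]
          tauto
        rw [this]
        exact hdeg z
    exact hle (by
      rw [SimpleGraph.sup_adj, SimpleGraph.edge_adj]
      exact .inr ⟨.inl ⟨rfl, rfl⟩, hxy.ne⟩)
  let Q : Finset V := Finset.univ.filter fun x => (F.neighborSet x).ncard = D
  have hsat : (Q.card : ℝ) * D ≤ ∑ x, ((F.neighborSet x).ncard : ℝ) := by
    calc (Q.card : ℝ) * D = ∑ x ∈ Q, ((F.neighborSet x).ncard : ℝ) := by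
          rw [Finset.sum_congr rfl fun x hx => by rw [(Finset.mem_filter.1 hx).2]]
          simp
      _ ≤ _ := Finset.sum_le_sum_of_subset_of_nonneg (Finset.subset_univ _)
          fun _ _ _ => Nat.cast_nonneg _
  have hdegH : ∀ x, (H.neighborSet x).ncard = ∑ y, if H.Adj x y then 1 else 0 := by
    intro x
    rw [← Finset.card_filter, ← Set.ncard_coe_finset]
    congr 1
    ext y
    simp
  have hcount : ∑ x, (H.neighborSet x).ncard ≤
      Fintype.card V * (D + 1) ^ g + 2 * ∑ x ∈ Q, (H.neighborSet x).ncard := by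
    calc ∑ x, (H.neighborSet x).ncard = ∑ x, ∑ y, (if H.Adj x y then 1 else 0) :=
          Finset.sum_congr rfl fun x _ => hdegH x
      _ ≤ ∑ x, ∑ y, ((if ∃ w : F.Walk x y, w.length ≤ g then 1 else 0) +
          (if x ∈ Q then (if H.Adj x y then 1 else 0) else 0) +
          (if y ∈ Q then (if H.Adj x y then 1 else 0) else 0)) := by
        refine Finset.sum_le_sum fun x _ => Finset.sum_le_sum fun y _ => ?_
        by_cases hxy : H.Adj x y
        · rcases hkey x y hxy with h | h | h
          · simp [h, hxy, add_assoc]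
          · have : x ∈ Q := by simpa [Q] using h
            simp only [hxy, this, if_true]
            omega
          · have : y ∈ Q := by simpa [Q] using h
            simp only [hxy, this, if_true]
            omega
        · simp [hxy]
      _ = ∑ x, (∑ y, if ∃ w : F.Walk x y, w.length ≤ g then 1 else 0) +
          ∑ x, (∑ y, if x ∈ Q then (if H.Adj x y then 1 else 0) else 0) +
          ∑ x, (∑ y, if y ∈ Q then (if H.Adj x y then 1 else 0) else 0) := by
        simp only [Finset.sum_add_distrib]
      _ ≤ Fintype.card V * (D + 1) ^ g + ∑ x ∈ Q, (H.neighborSet x).ncard +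
          ∑ x ∈ Q, (H.neighborSet x).ncard := by
        refine add_le_add (add_le_add ?_ (le_of_eq ?_)) (le_of_eq ?_)
        · refine (Finset.sum_le_card_nsmul _ _ ((D + 1) ^ g) fun x _ => ?_).trans (by simp)
          rw [← Finset.card_filter, ← Set.ncard_coe_finset]
          refine le_trans (le_of_eq ?_) (ncard_setOf_walk_le hdeg g x)
          congr 1
          ext y
          simp
        · rw [← Finset.sum_filter_add_sum_filter_not Finset.univ (fun x => x ∈ Q)]
          rw [Finset.sum_eq_zero (s := Finset.univ.filter fun x => ¬ x ∈ Q) (fun x hx => by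
            simp [(Finset.mem_filter.1 hx).2]), add_zero, Finset.filter_univ_mem]
          exact Finset.sum_congr rfl fun x hx => by simp only [hx, if_true]; exact (hdegH x).symm
        · rw [Finset.sum_comm, ← Finset.sum_filter_add_sum_filter_not Finset.univ (fun x => x ∈ Q)]
          rw [Finset.sum_eq_zero (s := Finset.univ.filter fun x => ¬ x ∈ Q) (fun x hx => by
            simp [(Finset.mem_filter.1 hx).2]), add_zero, Finset.filter_univ_mem]
          exact Finset.sum_congr rfl fun x hx => by
            simp only [hx, if_true, hdegH x, H.adj_comm]
      _ = _ := by ring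
  have hcount' : ∑ x, ((H.neighborSet x).ncard : ℝ) ≤
      Fintype.card V * ((D : ℝ) + 1) ^ g + 2 * ∑ x ∈ Q, ((H.neighborSet x).ncard : ℝ) := by
    exact_mod_cast hcount
  have h1 : ∑ x ∈ Q, ((H.neighborSet x).ncard : ℝ) ≤ Q.card * (q * d) := by
    simpa using Finset.sum_le_card_nsmul Q _ _ fun x _ => hΔ x
  have h2 : (Fintype.card V : ℝ) * ((D : ℝ) + 1) ^ g ≤ Fintype.card V * (d / 4) := by gcongr
  -- Close pairs account for at most half of the degree sum `d / 2 * |V|`; edges at `Q` contribute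
  -- at most `2 * q * d` per vertex of `Q`.
  have h3 : (Fintype.card V : ℝ) * d ≤ 8 * q * Q.card * d := by
    nlinarith
  have h4 := le_of_mul_le_mul_right h3 hd
  calc (Fintype.card V : ℝ) * D ≤ 8 * q * Q.card * D := by gcongr
    _ = 8 * q * (Q.card * D) := by ring
    _ ≤ _ := by gcongr

/-- Paths in a forest are unique, so the union of the two paths contains a cycle, which has no more
edges than the union. -/
theorem exists_short_cycle_of_ne {V : Type*} {F : SimpleGraph V} {u v : V} {p q : F.Walk u v}
    (hp : p.IsPath) (hq : q.IsPath) (hne : p ≠ q) :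
    ∃ (x : V) (c : F.Walk x x), c.IsCycle ∧ c.length ≤ p.length + q.length := by
  classical
  let T : SimpleGraph V := SimpleGraph.fromEdgeSet {e | e ∈ p.edges ∨ e ∈ q.edges}
  have hTF : T ≤ F := by
    intro a b hab
    rw [SimpleGraph.fromEdgeSet_adj] at hab
    rcases hab.1 with h | h
    · exact p.adj_of_mem_edges h
    · exact q.adj_of_mem_edges h
  have hT : ∀ e, (e ∈ p.edges ∨ e ∈ q.edges) → e ∈ T.edgeSet := by
    intro e he
    rw [SimpleGraph.edgeSet_fromEdgeSet]
    refine ⟨he, fun hd => ?_⟩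
    rcases he with h | h
    · exact F.not_isDiag_of_mem_edgeSet (p.edges_subset_edgeSet h) hd
    · exact F.not_isDiag_of_mem_edgeSet (q.edges_subset_edgeSet h) hd
  by_cases hac : T.IsAcyclic
  · exfalso
    have hp' := hp.transfer fun e he => hT e (.inl he)
    have hq' := hq.transfer fun e he => hT e (.inr he)
    have := congrArg Subtype.val ((hac.subsingleton_path u v).elim ⟨_, hp'⟩ ⟨_, hq'⟩)
    have h2 := congrArg SimpleGraph.Walk.support this
    simp only [SimpleGraph.Walk.support_transfer] at h2
    exact hne (SimpleGraph.Walk.ext_support h2)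
  · simp only [SimpleGraph.IsAcyclic, not_forall, not_not] at hac
    obtain ⟨x, c, hc⟩ := hac
    refine ⟨x, c.mapLe hTF, hc.mapLe hTF, ?_⟩
    rw [SimpleGraph.Walk.length_mapLe, ← SimpleGraph.Walk.length_edges,
      ← List.toFinset_card_of_nodup hc.isTrail.edges_nodup]
    calc c.edges.toFinset.card ≤ (p.edges.toFinset ∪ q.edges.toFinset).card := by
          refine Finset.card_le_card fun e he => ?_
          have := c.edges_subset_edgeSet (List.mem_toFinset.1 he)
          rw [SimpleGraph.edgeSet_fromEdgeSet] at this
          simpa using this.1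
      _ ≤ p.edges.toFinset.card + q.edges.toFinset.card := Finset.card_union_le _ _
      _ ≤ p.length + q.length := by
        refine add_le_add ?_ ?_
        · exact (List.toFinset_card_le _).trans (by simp)
        · exact (List.toFinset_card_le _).trans (by simp)

/-- In a graph of large girth a vertex close to `u` has at most one neighbour that is not farther
from `u`. -/
theorem parent_unique {V : Type*} {F : SimpleGraph V} {ρ : ℕ}
    (hF : ∀ (v : V) (c : F.Walk v v), c.IsCycle → 2 * ρ + 2 < c.length) {u x x' y : V}
    (hy : F.Reachable u y) (hyρ : F.dist u y ≤ ρ) (hx : F.Adj x y) (hx' : F.Adj x' y)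
    (hd : F.dist u x ≤ F.dist u y) (hd' : F.dist u x' ≤ F.dist u y) : x = x' := by
  classical
  have aux : ∀ z, F.Adj z y → F.dist u z ≤ F.dist u y →
      ∃ p : F.Walk u z, ∃ h : F.Adj z y, (p.concat h).IsPath ∧ (p.concat h).length ≤ ρ + 1 := by
    intro z hz hdz
    have hr : F.Reachable u z := hy.trans hz.symm.reachable
    obtain ⟨p, hp, hlen⟩ := hr.exists_path_of_dist
    refine ⟨p, hz, ?_, by rw [SimpleGraph.Walk.length_concat]; omega⟩
    rw [SimpleGraph.Walk.concat_isPath_iff]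
    -- A shortest path to `z` avoids `y`, for otherwise `y` would be strictly closer to `u` than
    -- `z`.
    refine ⟨hp, fun hmem => ?_⟩
    have h1 := SimpleGraph.dist_le (p.takeUntil y hmem)
    have h2 := p.length_takeUntil_lt_length hmem hz.ne'
    omega
  obtain ⟨p, h, hp, hlp⟩ := aux x hx hd
  obtain ⟨p', h', hp', hlp'⟩ := aux x' hx' hd'
  by_contra hne
  have hpp : p.concat h ≠ p'.concat h' := by
    intro he
    have := congrArg SimpleGraph.Walk.penultimate he
    rw [SimpleGraph.Walk.penultimate_concat, SimpleGraph.Walk.penultimate_concat] at this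
    exact hne this
  obtain ⟨z, c, hc, hlen⟩ := exists_short_cycle_of_ne hp hp' hpp
  have := hF z c hc
  omega

/-- Each edge is charged to an end farthest from a fixed `u ∈ W`. By `parent_unique` every vertex is
charged at most once, and each edge counts as two ordered pairs. -/
theorem adjCount_le_of_close {V : Type*} {F : SimpleGraph V} {ρ : ℕ}
    (hF : ∀ (v : V) (c : F.Walk v v), c.IsCycle → 2 * ρ + 2 < c.length) (W : Finset V)
    (hW : ∀ a ∈ W, ∀ b ∈ W, ∃ w : F.Walk a b, w.length ≤ ρ) :
    adjCount F W W ≤ 2 * W.card := by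
  classical
  rcases W.eq_empty_or_nonempty with rfl | ⟨u, hu⟩
  · simp [adjCount]
  have hcol : ∀ y ∈ W, ∑ x ∈ W, (if F.Adj x y ∧ F.dist u x ≤ F.dist u y then 1 else 0) ≤ 1 := by
    intro y hy
    obtain ⟨w, hw⟩ := hW u hu y hy
    rw [← Finset.card_filter, Finset.card_le_one]
    intro x hx x' hx'
    have h1 := (Finset.mem_filter.1 hx).2
    have h2 := (Finset.mem_filter.1 hx').2
    exact parent_unique hF ⟨w⟩ ((SimpleGraph.dist_le w).trans hw) h1.1 h2.1 h1.2 h2.2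
  calc adjCount F W W ≤ ∑ x ∈ W, ∑ y ∈ W,
        ((if F.Adj x y ∧ F.dist u x ≤ F.dist u y then 1 else 0) +
          (if F.Adj y x ∧ F.dist u y ≤ F.dist u x then 1 else 0)) := by
        refine Finset.sum_le_sum fun x _ => Finset.sum_le_sum fun y _ => ?_
        by_cases hxy : F.Adj x y
        · rcases le_total (F.dist u x) (F.dist u y) with h | h
          · simp [hxy, h]
          · simp [hxy, hxy.symm, h]
        · simp [hxy]
    _ = ∑ y ∈ W, ∑ x ∈ W, (if F.Adj x y ∧ F.dist u x ≤ F.dist u y then 1 else 0) +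
        ∑ x ∈ W, ∑ y ∈ W, (if F.Adj y x ∧ F.dist u y ≤ F.dist u x then 1 else 0) := by
      simp only [Finset.sum_add_distrib]
      rw [Finset.sum_comm]
    _ ≤ W.card + W.card := by
      refine add_le_add ?_ ?_
      · exact (Finset.sum_le_card_nsmul _ _ 1 hcol).trans (by simp)
      · exact (Finset.sum_le_card_nsmul _ _ 1 hcol).trans (by simp)
    _ = 2 * W.card := (two_mul _).symm

/-! ### Covers of subdivisions of graphs of large girth -/

theorem exists_walk_coe {V : Type*} {G : SimpleGraph V} {S : G.Subgraph} {a b : V}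
    (w : G.Walk a b) (hw : ∀ x y, s(x, y) ∈ w.edges → S.Adj x y) (ha : a ∈ S.verts)
    (hb : b ∈ S.verts) : ∃ w' : S.coe.Walk ⟨a, ha⟩ ⟨b, hb⟩, w'.length = w.length := by
  induction w with
  | nil => exact ⟨.nil, rfl⟩
  | @cons a c b h w ih =>
    have hac : S.Adj a c := hw a c (by simp)
    obtain ⟨w', hw'⟩ := ih (fun x y hxy => hw x y (by simp [hxy])) (S.edge_vert hac.symm) hb
    exact ⟨.cons (show S.coe.Adj ⟨a, ha⟩ ⟨c, S.edge_vert hac.symm⟩ from hac) w', by simp [hw']⟩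

theorem exists_walk_of_coverRadius_le {V : Type*} {G : SimpleGraph V} {𝒳 : Set G.Subgraph}
    {R : ℕ} (hR : coverRadius 𝒳 ≤ R) {X : G.Subgraph} (hX : X ∈ 𝒳) {a b : V}
    (ha : a ∈ X.verts) (hb : b ∈ X.verts) : ∃ w : G.Walk a b, w.length ≤ 2 * R := by
  have hXR : X.coe.radius ≤ R := (le_iSup₂ (f := fun (X : G.Subgraph) (_ : X ∈ 𝒳) => X.coe.radius)
    X hX).trans hR
  have : Nonempty X.verts := ⟨⟨a, ha⟩⟩
  obtain ⟨z, hz⟩ := X.coe.exists_eccent_eq_radius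
  have hwalk : ∀ y : X.verts, ∃ w : X.coe.Walk z y, w.length ≤ R := by
    intro y
    have h1 : X.coe.edist z y ≤ R := (SimpleGraph.edist_le_eccent.trans hz.le).trans hXR
    obtain ⟨w, hw⟩ := SimpleGraph.exists_walk_of_edist_ne_top
      (ne_top_of_le_ne_top (ENat.natCast_ne_top R) h1)
    rw [← hw] at h1
    exact ⟨w, by exact_mod_cast h1⟩
  obtain ⟨p, hp⟩ := hwalk ⟨a, ha⟩
  obtain ⟨q, hq⟩ := hwalk ⟨b, hb⟩
  suffices ∃ w : G.Walk (X.hom ⟨a, ha⟩) (X.hom ⟨b, hb⟩), w.length ≤ 2 * R from this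
  refine ⟨(p.reverse.append q).map X.hom, ?_⟩
  rw [SimpleGraph.Walk.length_map, SimpleGraph.Walk.length_append,
    SimpleGraph.Walk.length_reverse]
  omega

/-- `S` is exactly the subdivision of `F`, so distances in `S` between branch vertices are at least
those in `F`. The branch vertices of a cluster are thus within `2 * R` of each other in `F`, and
`adjCount_le_of_close` applies. -/
theorem adjCount_le_of_cover {W V : Type*} [Fintype W] [Finite V] {ℓ R : ℕ} {F : SimpleGraph W}
    {G : SimpleGraph V} (hFG : ContainsSubdivision ℓ F G)
    (hF : ∀ (v : W) (c : F.Walk v v), c.IsCycle → 2 * (2 * R) + 2 < c.length) :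
    ∃ S : G.Subgraph, Fintype.card W ≤ Nat.card S.verts ∧
      ∀ 𝒳 : Set S.coe.Subgraph, IsNbhdCover S.coe (ℓ + 1) 𝒳 → coverRadius 𝒳 ≤ R →
        adjCount F Finset.univ Finset.univ ≤ 2 * (Fintype.card W * coverDegree 𝒳) := by
  classical
  obtain ⟨f, P, hsymm, hpath, hbranch, hint⟩ := hFG
  let S : G.Subgraph :=
    { verts := {x | x ∈ Set.range f ∨ ∃ u v, ∃ h : F.Adj u v, x ∈ (P u v h).support}
      Adj := fun x y => ∃ u v, ∃ h : F.Adj u v, s(x, y) ∈ (P u v h).edges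
      adj_sub := by
        rintro x y ⟨u, v, h, hxy⟩
        exact (P u v h).adj_of_mem_edges hxy
      edge_vert := by
        rintro x y ⟨u, v, h, hxy⟩
        exact .inr ⟨u, v, h, (P u v h).fst_mem_support_of_mem_edges hxy⟩
      symm := ⟨by
        rintro x y ⟨u, v, h, hxy⟩
        exact ⟨u, v, h, by rwa [Sym2.eq_swap]⟩⟩ }
  have hfS : ∀ a, f a ∈ S.verts := fun a => .inl ⟨a, rfl⟩
  let F' : W → S.verts := fun a => ⟨f a, hfS a⟩
  have hF'inj : Function.Injective F' := fun a b hab => f.injective (congrArg Subtype.val hab)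
  refine ⟨S, ?_, fun 𝒳 hcov hR => ?_⟩
  · rw [← Nat.card_eq_fintype_card]
    exact Nat.card_le_card_of_injective F' hF'inj
  -- the ends of the subdivided edge through `x`
  let near : W → V → Prop := fun a x =>
    x = f a ∨ x ∉ Set.range f ∧ ∃ v, ∃ h : F.Adj a v, x ∈ (P a v h).support
  have hend : ∀ {u v} (h : F.Adj u v) {y a}, (a = u ∨ a = v) → y ∈ (P u v h).support →
      ∃ b, near b y ∧ (a = b ∨ F.Adj a b) := by
    intro u v h y a ha hy
    by_cases hyr : y ∈ Set.range f
    · obtain ⟨b, rfl⟩ := hyr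
      refine ⟨b, .inl rfl, ?_⟩
      rcases hbranch u v h b hy with rfl | rfl <;> rcases ha with rfl | rfl
      · exact .inl rfl
      · exact .inr h.symm
      · exact .inr h
      · exact .inl rfl
    · refine ⟨a, .inr ⟨hyr, ?_⟩, .inl rfl⟩
      rcases ha with rfl | rfl
      · exact ⟨v, h, hy⟩
      · refine ⟨u, h.symm, ?_⟩
        rw [hsymm u a h, SimpleGraph.Walk.support_reverse, List.mem_reverse]
        exact hy
  have hstep : ∀ {x y a}, S.Adj x y → near a x → ∃ b, near b y ∧ (a = b ∨ F.Adj a b) := by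
    rintro x y a ⟨u, v, h, hxy⟩ hax
    have hx := (P u v h).fst_mem_support_of_mem_edges hxy
    have hy := (P u v h).snd_mem_support_of_mem_edges hxy
    refine hend h ?_ hy
    rcases hax with rfl | ⟨hxr, v', h', hx'⟩
    · exact hbranch u v h a hx
    · have : s(a, v') = s(u, v) := by
        by_contra hne
        exact hxr (hint a v' h' u v h hne x hx' hx)
      rw [Sym2.eq_iff] at this
      exact this.imp And.left And.left
  -- A walk in the subdivision projects to one in `F` that is no longer: each step keeps the current
  -- nearby branch vertex or moves along an edge of `F`.
  have hproj : ∀ {x y : S.verts} (w : S.coe.Walk x y) (a : W), near a x →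
      ∃ b, near b y ∧ ∃ q : F.Walk a b, q.length ≤ w.length := by
    intro x y w
    induction w with
    | nil => exact fun a ha => ⟨a, ha, .nil, by simp⟩
    | @cons x z y h w ih =>
      intro a ha
      obtain ⟨b, hb, hab⟩ := hstep h ha
      obtain ⟨c, hc, q, hq⟩ := ih b hb
      rw [SimpleGraph.Walk.length_cons]
      rcases hab with rfl | hab
      · exact ⟨c, hc, q, by omega⟩
      · exact ⟨c, hc, .cons hab q, by rw [SimpleGraph.Walk.length_cons]; omega⟩
  let WX : S.coe.Subgraph → Finset W := fun X => Finset.univ.filter fun a => F' a ∈ X.verts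
  have hWX : ∀ X a, a ∈ WX X ↔ F' a ∈ X.verts := by simp [WX]
  have hcluster : ∀ X ∈ 𝒳, adjCount F (WX X) (WX X) ≤ 2 * (WX X).card := by
    intro X hX
    refine adjCount_le_of_close hF _ fun a ha b hb => ?_
    obtain ⟨w, hw⟩ := exists_walk_of_coverRadius_le hR hX ((hWX X a).1 ha) ((hWX X b).1 hb)
    obtain ⟨c, hc, q, hq⟩ := hproj w a (.inl rfl)
    have : c = b := by
      rcases hc with h | ⟨h, -⟩
      · exact (f.injective h).symm
      · exact absurd ⟨b, rfl⟩ h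
    subst this
    exact ⟨q, hq.trans hw⟩
  have hcovers : ∀ a b, F.Adj a b → ∃ X ∈ 𝒳, a ∈ WX X ∧ b ∈ WX X := by
    intro a b hab
    obtain ⟨X, hX, hsub⟩ := hcov.2 (F' a)
    refine ⟨X, hX, (hWX X a).2 (hsub ?_), (hWX X b).2 (hsub ?_)⟩
    · simp [nbhd]
    · obtain ⟨w, hw⟩ := exists_walk_coe (S := S) (P a b hab)
        (fun x y hxy => ⟨a, b, hab, hxy⟩) (hfS a) (hfS b)
      refine (SimpleGraph.edist_le w).trans ?_
      exact_mod_cast hw.le.trans (hpath a b hab).2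
  have hfin : 𝒳.Finite := Set.toFinite 𝒳
  -- Double counting: every edge is counted in a cluster containing both ends, and the cluster sizes
  -- add up to the degrees of the branch vertices.
  calc adjCount F Finset.univ Finset.univ
      ≤ ∑ a, ∑ b, ∑ X ∈ hfin.toFinset,
          (if a ∈ WX X then (if b ∈ WX X then (if F.Adj a b then 1 else 0) else 0) else 0) := by
        refine Finset.sum_le_sum fun a _ => Finset.sum_le_sum fun b _ => ?_
        by_cases hab : F.Adj a b
        · obtain ⟨X, hX, ha, hb⟩ := hcovers a b hab
          refine le_trans ?_ (Finset.single_le_sum (fun _ _ => Nat.zero_le _)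
            (hfin.mem_toFinset.2 hX))
          simp [ha, hb]
        · simp [hab]
    _ = ∑ X ∈ hfin.toFinset, adjCount F (WX X) (WX X) := by
        rw [Finset.sum_congr rfl fun a _ => Finset.sum_comm, Finset.sum_comm]
        refine Finset.sum_congr rfl fun X _ => ?_
        simp only [adjCount]
        rw [← Finset.sum_subset (Finset.subset_univ (WX X)) fun a _ ha => by simp [ha]]
        refine Finset.sum_congr rfl fun a ha => ?_
        rw [← Finset.sum_subset (Finset.subset_univ (WX X)) fun b _ hb => by simp [hb]]
        exact Finset.sum_congr rfl fun b hb => by simp [ha, hb]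
    _ ≤ ∑ X ∈ hfin.toFinset, 2 * (WX X).card :=
        Finset.sum_le_sum fun X hX => hcluster X (hfin.mem_toFinset.1 hX)
    _ = 2 * ∑ a, degreeAt 𝒳 (F' a) := by
        rw [← Finset.mul_sum]
        congr 1
        simp only [WX, Finset.card_filter]
        rw [Finset.sum_comm]
        refine Finset.sum_congr rfl fun a _ => ?_
        rw [← Finset.card_filter, degreeAt, ← Set.ncard_coe_finset]
        congr 1
        ext X
        simp
    _ ≤ 2 * (Fintype.card W * coverDegree 𝒳) := by
        refine Nat.mul_le_mul_left _ ?_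
        exact (Finset.sum_le_card_nsmul _ _ _ fun a _ => degreeAt_le_coverDegree 𝒳 (F' a)).trans
          (by simp)

/-! ### Monotone classes with sparse covers are nowhere dense -/

theorem exists_large_minor_of_lt_topGrad {V : Type*} [Finite V] {G : SimpleGraph V} {r : ℕ}
    {D : ℝ} (hD : 0 < D) (h : D < topGrad r G) : ∃ (m : ℕ) (_ : Nonempty (Fin m))
      (H : SimpleGraph (Fin m)), IsTopMinor r H G ∧ m ≤ Nat.card V ∧
      D * Fintype.card (Fin m) ≤ adjCount H Finset.univ Finset.univ := by
  obtain ⟨m, H, hH, hdens⟩ := (isGreatest_topGrad r G).1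
  rw [← hdens, edgeDensity, Nat.card_fin] at h
  have hm : m ≠ 0 := by
    rintro rfl
    simp only [Nat.cast_zero, div_zero] at h
    linarith
  have hm0 : (0 : ℝ) < m := by exact_mod_cast Nat.pos_of_ne_zero hm
  refine ⟨m, ⟨⟨0, Nat.pos_of_ne_zero hm⟩⟩, H, hH, ?_, ?_⟩
  · obtain ⟨f, -⟩ := hH
    simpa using Finite.card_le_of_embedding f
  · rw [lt_div_iff₀ hm0] at h
    rw [adjCount_univ, Fintype.card_fin]
    push_cast
    have : (0 : ℝ) ≤ H.edgeSet.ncard := Nat.cast_nonneg _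
    linarith

/-- A sufficiently dense topological minor yields a subgraph all of whose covers of a given radius
have large degree. -/
theorem exists_subgraph_of_dense_minor {q : ℕ} {V : Type*} [Finite V] {G : SimpleGraph V}
    {m ℓ R D : ℕ} {H : SimpleGraph (Fin m)} (hH : ContainsSubdivision ℓ H G)
    {S : Finset (Fin m)} (hS : S.Nonempty) {d : ℝ} (hd : 0 < d)
    (hE : d / 2 * S.card ≤ adjCount H S S) (hΔ : ∀ x ∈ S, (adjCount H {x} S : ℝ) ≤ q * d)
    (hD : ((D : ℝ) + 1) ^ (2 * (2 * R) + 2) ≤ d / 4) :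
    ∃ T : G.Subgraph, d / 2 ≤ Nat.card T.verts ∧
      ∀ 𝒳 : Set T.coe.Subgraph, IsNbhdCover T.coe (ℓ + 1) 𝒳 → coverRadius 𝒳 ≤ R →
        (D : ℝ) ≤ 16 * q * coverDegree 𝒳 := by
  classical
  have hScard : (0 : ℝ) < S.card := by exact_mod_cast hS.card_pos
  have hcard : Fintype.card (S : Set (Fin m)) = S.card := by simp
  have hsum : ∑ x : (S : Set (Fin m)), (((H.induce (S : Set (Fin m))).neighborSet x).ncard : ℝ) =
      adjCount H S S := by
    rw [adjCount_eq_sum_singleton]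
    push_cast
    rw [← Finset.sum_coe_sort S]
    exact Finset.sum_congr rfl fun x _ => by rw [ncard_neighborSet_induce]
  obtain ⟨F, hFH, hgirth, hF⟩ := exists_high_girth_subgraph (H.induce (S : Set (Fin m)))
    (g := 2 * (2 * R) + 2) (q := q) (D := D) (by omega) hd (by rw [hsum, hcard]; exact hE)
    (fun x => by rw [ncard_neighborSet_induce]; exact hΔ x x.2) hD
  have hsub : ContainsSubdivision ℓ F G :=
    hH.comap (Function.Embedding.subtype _) fun u v huv => hFH huv
  obtain ⟨T, hT, hcov⟩ := adjCount_le_of_cover (R := R) hsub hgirth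
  rw [hcard] at hT hF
  refine ⟨T, ?_, fun 𝒳 h𝒳 hR => ?_⟩
  -- A graph of average degree at least `d / 2` has at least that many vertices. This makes `T`
  -- large enough for the covering hypothesis.
  · have h1 : (adjCount H S S : ℝ) ≤ S.card * S.card := by exact_mod_cast adjCount_le_mul S S
    have h2 : d / 2 ≤ S.card := le_of_mul_le_mul_right (hE.trans h1) hScard
    exact h2.trans (by exact_mod_cast hT)
  · have h1 := hcov 𝒳 h𝒳 hR
    rw [hcard] at h1
    have h2 : ∑ x, ((F.neighborSet x).ncard : ℝ) = adjCount F Finset.univ Finset.univ := by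
      rw [adjCount_eq_sum_singleton]
      push_cast
      exact Finset.sum_congr rfl fun x _ => by
        rw [adjCount_singleton, Finset.coe_univ, Set.inter_univ]
    have h3 : (adjCount F Finset.univ Finset.univ : ℝ) ≤ 2 * (S.card * coverDegree 𝒳) := by
      exact_mod_cast h1
    rw [h2] at hF
    have h4 : (S.card : ℝ) * D ≤ S.card * (16 * q * coverDegree 𝒳) := by
      calc (S.card : ℝ) * D ≤ 8 * q * adjCount F Finset.univ Finset.univ := hF
        _ ≤ 8 * q * (2 * (S.card * coverDegree 𝒳)) := by gcongr
        _ = S.card * (16 * q * coverDegree 𝒳) := by ring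
    exact le_of_mul_le_mul_left h4 hScard

theorem isNowhereDense_of_admitsSparseCovers {C : Set FinGraph.{u}} (hC : IsMonotone C)
    (hcov : AdmitsSparseCovers C) : IsNowhereDense C := by
  by_contra hnd
  unfold IsNowhereDense at hnd
  push Not at hnd
  obtain ⟨ε, hε, r, hdense⟩ := hnd
  -- The radius `2 * r + 1` is the maximal length of a subdivided edge, so both ends of each edge
  -- share a cluster.
  obtain ⟨c, hc⟩ := hcov (2 * r + 1)
  set R := c * (2 * r + 1) with hR
  set g := 2 * (2 * R) + 2 with hg
  have hg0 : (0 : ℝ) < g := by rw [hg]; positivity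
  obtain ⟨q, hq, hreg⟩ := exists_almost_regular (α := ε / 2) (by positivity)
  have hq0 : (0 : ℝ) < q := by exact_mod_cast hq
  -- The exponent depends on `g`, hence on `c`. Covers will have degree at most `x = n ^ (ε / (8 *
  -- g))`, against a degree parameter of about `x ^ 2` for the subgraph of large girth.
  obtain ⟨n₁, hn₁⟩ := hc (ε / (8 * g)) (by positivity)
  -- The term `2 * n₁` ensures that the subgraph `T`, and not only `G`, has at least `n₁` vertices.
  obtain ⟨n₂, hn₂⟩ := exists_le_rpow (max q (2 * n₁)) (ε / 2) (by positivity)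
  obtain ⟨n₃, hn₃⟩ := exists_le_rpow (4 * 2 ^ g) (ε / 4) (by positivity)
  obtain ⟨n₄, hn₄⟩ := exists_le_rpow (32 * q + 1) (ε / (8 * g)) (by positivity)
  obtain ⟨G, hGC, hGn, hG⟩ := hdense (max (max n₁ n₂) (max (max n₃ n₄) 1))
  set n := G.order with hndef
  have hn1 : (1 : ℝ) ≤ n := by
    have : 1 ≤ n := by omega
    exact_mod_cast this
  have hn0 : (0 : ℝ) < n := by linarith
  have hn₂' := hn₂ n (by omega)
  have hn₃' := hn₃ n (by omega)
  have hn₄' := hn₄ n (by omega)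
  obtain ⟨m, hm, H, hH, hmn, hHE⟩ := exists_large_minor_of_lt_topGrad (Real.rpow_pos_of_pos hn0 ε) hG
  have hmα : ((Fintype.card (Fin m) : ℕ) : ℝ) ^ (ε / 2) ≤ (n : ℝ) ^ (ε / 2) := by
    rw [Fintype.card_fin]
    exact Real.rpow_le_rpow (Nat.cast_nonneg _) (by exact_mod_cast hmn) (by positivity)
  have hsplit : (n : ℝ) ^ ε = (n : ℝ) ^ (ε / 2) * (n : ℝ) ^ (ε / 2) := by
    rw [← Real.rpow_add hn0]
    congr 1
    ring
  have hpos : 0 < (n : ℝ) ^ (ε / 2) := Real.rpow_pos_of_pos hn0 _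
  have hm0 : (0 : ℝ) < ((Fintype.card (Fin m) : ℕ) : ℝ) ^ (ε / 2) :=
    Real.rpow_pos_of_pos (by exact_mod_cast Fintype.card_pos) _
  obtain ⟨S, hS, d, hd, hSE, hSΔ⟩ := hreg H _ hHE (by
    rw [hsplit]
    exact mul_le_mul ((le_max_left _ _).trans hn₂') hmα hm0.le hpos.le)
  have hdn : (n : ℝ) ^ (ε / 2) ≤ d := by
    refine le_trans ?_ hd
    rw [le_div_iff₀ hm0, hsplit]
    gcongr
  set x : ℝ := (n : ℝ) ^ (ε / (8 * g)) with hx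
  have hx1 : 1 ≤ x := Real.one_le_rpow hn1 (by positivity)
  have hxg : (x ^ 2) ^ g = (n : ℝ) ^ (ε / 4) := by
    rw [← pow_mul, hx, ← Real.rpow_natCast, ← Real.rpow_mul hn0.le]
    congr 1
    push_cast
    field_simp
    norm_num
  obtain ⟨T, hT, hTcov⟩ := exists_subgraph_of_dense_minor (q := q) (R := R) (D := ⌊x ^ 2⌋₊) hH hS
    (hpos.trans_le hdn) hSE hSΔ (by
      have h1 : (⌊x ^ 2⌋₊ : ℝ) + 1 ≤ 2 * x ^ 2 := by
        have := Nat.floor_le (show 0 ≤ x ^ 2 by positivity)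
        nlinarith
      have h2 : (n : ℝ) ^ (ε / 2) = (n : ℝ) ^ (ε / 4) * (n : ℝ) ^ (ε / 4) := by
        rw [← Real.rpow_add hn0]
        congr 1
        ring
      have h3 : 0 < (n : ℝ) ^ (ε / 4) := Real.rpow_pos_of_pos hn0 _
      calc ((⌊x ^ 2⌋₊ : ℝ) + 1) ^ g ≤ (2 * x ^ 2) ^ g := by gcongr
        _ = 2 ^ g * (n : ℝ) ^ (ε / 4) := by rw [mul_pow, hxg]
        _ ≤ (n : ℝ) ^ (ε / 2) / 4 := by rw [h2]; nlinarith
        _ ≤ d / 4 := by linarith)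
  have hTn : Nat.card T.verts ≤ n := Nat.card_le_card_of_injective _ Subtype.val_injective
  obtain ⟨𝒳, h1, h2, h3⟩ := hn₁ _ (hC G hGC T) (by
    have h1 : (2 * n₁ : ℝ) ≤ d := ((le_max_right _ _).trans hn₂').trans hdn
    have h2 : (n₁ : ℝ) ≤ Nat.card T.verts := by linarith
    exact_mod_cast h2)
  have h4 := hTcov 𝒳 h1 h2
  have h5 : (coverDegree 𝒳 : ℝ) ≤ x :=
    h3.trans (Real.rpow_le_rpow (Nat.cast_nonneg _) (by exact_mod_cast hTn) (by positivity))
  -- Together the bounds give `x ^ 2 < 16 * q * x + 1`, which is impossible for `x ≥ 32 * q + 1`.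
  have h6 : x ^ 2 < ⌊x ^ 2⌋₊ + 1 := Nat.lt_floor_add_one _
  have h7 : 16 * q * (coverDegree 𝒳 : ℝ) ≤ 16 * q * x := by gcongr
  nlinarith

end SparseCovers

theorem mainTheorem8 (C : Set SparseCovers.FinGraph) (hC : SparseCovers.IsMonotone C) :
    (SparseCovers.IsSomewhereDense C → ¬ SparseCovers.AdmitsSparseCovers C) ∧
    (SparseCovers.IsNowhereDense C ↔ SparseCovers.AdmitsSparseCovers C) :=
  ⟨fun h hcov => h (SparseCovers.isNowhereDense_of_admitsSparseCovers hC hcov),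
    SparseCovers.admitsSparseCovers_of_isNowhereDense,
    SparseCovers.isNowhereDense_of_admitsSparseCovers hC⟩
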